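/- Let $\Omega\subset\mathbb R^2$ be a bounded Lipschitz domain (open, connected) with arc-length measure $\sigma$ on $\partial\Omega$, and let $\Gamma_D,\Gamma_N,\Gamma_R$ be pairwise disjoint relatively open subsets of $\partial\Omega$, each of positive $\sigma$-measure, with $\partial\Omega=\overline{\Gamma_D}\cup\overline{\Gamma_N}\cup\overline{\Gamma_R}$. Let $V=\{v\in H^1(\Omega): v=0 \text{ on } \Gamma_D\}$ (in the sense of traces), with the norm $\|v\|_V=\|\nabla v\|_{L^2(\Omega)}$. For a part $\Gamma$ of $\partial\Omega$ and $p\ge 1$ put $$c_p(\Gamma)=\inf\{C>0:\ \|v_{|\Gamma}\|_{L^p(\Gamma)}\le C\|v\|_V\ \text{ for all } v\in V\},$$ and let $\beta_1=c_2(\Gamma_R)$, $\beta_2=c_3(\Gamma_R)$ and $\beta_N=c_2(\Gamma_N)$. Let $\alpha\in(0,1)$, $\phi\in L^2(\Gamma_N)$, $g\in L^2(\Gamma_R)$, and $$M_0=2\max(\beta_1,\beta_N)\big(\|\phi\|_{L^2(\Gamma_N)}+\|g\|_{L^2(\Gamma_R)}\big).$$ Let $\varepsilon$ be a real number with $0<\varepsilon<\min\Big(\dfrac1{4\beta_1^2},\dfrac1{2\beta_2^3M_0}\Big)$,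 where $1/0$ is read as $+\infty$, and let $\varphi\in C(\overline{\Gamma_R})$ with $\|\varphi\|_{L^\infty(\Gamma_R)}<\varepsilon$. Consider the problem $$(RP)\quad \Delta u=0 \text{ in }\Omega,\qquad u=0\text{ on }\Gamma_D,\qquad \frac{\partial u}{\partial n}=\phi\text{ on }\Gamma_N,\qquad \frac{\partial u}{\partial n}+\varphi\Big(u+\frac{2\alpha-1}{2}u^2\Big)=g\text{ on }\Gamma_R,$$ whose weak solutions are the $u\in V$ such that, for all $v\in V$, $$\int_\Omega\nabla u\cdot\nabla v+\int_{\Gamma_R}\varphi\Big(u+\frac{2\alpha-1}{2}u^2\Big)v\,d\sigma=\int_{\Gamma_N}\phi v\,d\sigma+\int_{\Gamma_R}gv\,d\sigma .$$ Then: 1. $(RP)$ has a weak solution $u\in V$ with $\|u\|_V\le M_0$. 2. This solution is the only weak solution of $(RP)$ in $\{h\in V:\|h\|_V\le M_0\}$. -/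

import Mathlib

open MeasureTheory Filter Topology
open scoped ENNReal NNReal ContDiff

noncomputable section

namespace RobinProblem

/-- The Euclidean plane. -/
abbrev Plane : Type := EuclideanSpace ℝ (Fin 2)

/-- A bounded Lipschitz domain of the plane: a bounded, connected, open set which near each of its
boundary points is, in suitable orthonormal coordinates, the strict epigraph of a Lipschitz
function. -/
structure IsLipschitzDomain (Ω : Set Plane) : Prop where
  isOpen : IsOpen Ω
  isBounded : Bornology.IsBounded Ω
  isConnected : IsConnected Ω
  chart : ∀ x ∈ frontier Ω, ∃ (e : Plane ≃ₗᵢ[ℝ] Plane) (γ : ℝ → ℝ) (K : ℝ≥0) (r : ℝ),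
    LipschitzWith K γ ∧ 0 < r ∧ ∀ y ∈ Metric.ball x r, y ∈ Ω ↔ γ (e y 0) < e y 1

/-- The superficial (arc length) measure on the boundary of `Ω`. -/
def surf (Ω : Set Plane) : Measure Plane := (Measure.hausdorffMeasure 1).restrict (frontier Ω)

/-- The boundary is decomposed into a Dirichlet, a Neumann and a Robin part: relatively open,
pairwise disjoint, of positive superficial measure, and with closures that cover the boundary. -/
structure IsBoundaryPartition (Ω ΓD ΓN ΓR : Set Plane) : Prop where
  openD : ∃ U, IsOpen U ∧ ΓD = U ∩ frontier Ω
  openN : ∃ U, IsOpen U ∧ ΓN = U ∩ frontier Ω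
  openR : ∃ U, IsOpen U ∧ ΓR = U ∩ frontier Ω
  cover : frontier Ω = closure ΓD ∪ closure ΓN ∪ closure ΓR
  disjDN : Disjoint ΓD ΓN
  disjDR : Disjoint ΓD ΓR
  disjNR : Disjoint ΓN ΓR
  posD : 0 < surf Ω ΓD
  posN : 0 < surf Ω ΓN
  posR : 0 < surf Ω ΓR

/-- `G` is the weak (distributional) gradient of `u` on `Ω`. -/
def IsWeakGradient (Ω : Set Plane) (u : Plane → ℝ) (G : Plane → Plane) : Prop :=
  ∀ η : Plane → ℝ, ContDiff ℝ ∞ η → HasCompactSupport η → tsupport η ⊆ Ω →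
    ∀ e : Plane, ∫ x in Ω, u x * fderiv ℝ η x e = -∫ x in Ω, inner ℝ (G x) e * η x

/-- The Sobolev space `H¹(Ω)`. An element is a class `val ∈ L²(Ω)` together with its weak
gradient `grad ∈ L²(Ω)`, which is determined by `val`. -/
structure H1 (Ω : Set Plane) where
  val : Lp ℝ 2 (volume.restrict Ω)
  grad : Lp Plane 2 (volume.restrict Ω)
  isWeakGradient : IsWeakGradient Ω val grad

/-- `t ∈ L²(∂Ω)` is the trace of `u ∈ H¹(Ω)`: the trace map is the continuous extension to `H¹(Ω)`
of the restriction to `∂Ω` of functions that are smooth up to the boundary. -/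
def IsTrace {Ω : Set Plane} (u : H1 Ω) (t : Lp ℝ 2 (surf Ω)) : Prop :=
  ∃ w : ℕ → Plane → ℝ, (∀ n, ContDiff ℝ ∞ (w n) ∧ HasCompactSupport (w n)) ∧
    Tendsto (fun n => eLpNorm (fun x => w n x - u.val x) 2 (volume.restrict Ω)) atTop (𝓝 0) ∧
    Tendsto (fun n => eLpNorm (fun x => gradient (w n) x - u.grad x) 2 (volume.restrict Ω))
      atTop (𝓝 0) ∧
    Tendsto (fun n => eLpNorm (fun x => w n x - t x) 2 (surf Ω)) atTop (𝓝 0)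

/-- The space `V = {v ∈ H¹(Ω) : v = 0 on ΓD}`. An element carries its trace on `∂Ω`, which on a
Lipschitz domain exists and is determined by the `H¹` function. -/
structure V (Ω ΓD : Set Plane) extends H1 Ω where
  trace : Lp ℝ 2 (surf Ω)
  isTrace : IsTrace toH1 trace
  trace_eq_zero : ∀ᵐ x ∂(surf Ω).restrict ΓD, trace x = 0

/-- The norm `‖u‖_V = ‖∇u‖_{L²(Ω)}`. -/
def normV {Ω ΓD : Set Plane} (u : V Ω ΓD) : ℝ≥0∞ := eLpNorm u.grad 2 (volume.restrict Ω)

/-- The best constant `inf {C > 0 : ‖u‖_{L^p(Γ)} ≤ C ‖u‖_V for all u ∈ V}` for the trace on a part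
`Γ` of the boundary (the infimum is taken in `[0, ∞]`). -/
def traceConst (Ω ΓD Γ : Set Plane) (p : ℝ≥0∞) : ℝ≥0∞ :=
  ⨅ (C : ℝ≥0) (_ : 0 < C ∧
    ∀ u : V Ω ΓD, eLpNorm u.trace p ((surf Ω).restrict Γ) ≤ C * normV u), (C : ℝ≥0∞)

/-- The radius `M₀`; `Φ` is the Neumann datum on `ΓN` and `g` the Robin datum on `ΓR`. -/
def M₀ (Ω ΓD ΓN ΓR : Set Plane) (Φ g : Plane → ℝ) : ℝ≥0∞ :=
  2 * max (traceConst Ω ΓD ΓR 2) (traceConst Ω ΓD ΓN 2) *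
    (eLpNorm Φ 2 ((surf Ω).restrict ΓN) + eLpNorm g 2 ((surf Ω).restrict ΓR))

/-- `u ∈ V` is a weak solution of `Δu = 0` in `Ω`, `u = 0` on `ΓD`, `∂u/∂n = Φ` on `ΓN`,
`∂u/∂n + φ (u + (2α - 1)/2 u²) = g` on `ΓR`. -/
def IsWeakSolution {Ω ΓD : Set Plane} (ΓN ΓR : Set Plane) (α : ℝ) (φ Φ g : Plane → ℝ)
    (u : V Ω ΓD) : Prop :=
  ∀ v : V Ω ΓD,
    (∫ x in Ω, inner ℝ (u.grad x) (v.grad x)) +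
      (∫ x in ΓR, φ x * (u.trace x + (2 * α - 1) / 2 * u.trace x ^ 2) * v.trace x ∂(surf Ω)) =
    (∫ x in ΓN, Φ x * v.trace x ∂(surf Ω)) + ∫ x in ΓR, g x * v.trace x ∂(surf Ω)

end RobinProblem

end

open RobinProblem

/-!
The gradient identifies `V` with a Hilbert space `H` on which the trace is bounded: on a Lipschitz
domain, integrating along segments transversal to the boundary controls both the `L²` norm and the
trace of a smooth function by its gradient and its trace on `ΓD`.

In `H` the weak equation reads `u + B u + Q(u, u) = ℓ`, where Hölder's inequality with exponents
`(∞, 2, 2)` and `(∞, 3, 3, 3)` gives `‖B‖ ≤ ε β₁² ≤ 1/4` and `M₀ ‖Q‖ ≤ ε β₂³ M₀ / 2 ≤ 1/4`, while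
`‖ℓ‖ ≤ M₀ / 2`. Hence `u ↦ ℓ - B u - Q(u, u)` maps the ball of radius `M₀` into itself and is
`3/4`-Lipschitz there.
-/

noncomputable section

namespace RobinProblem

section Segments

theorem lintegral_sq_le {X : Type*} [MeasurableSpace X] {μ : Measure X} {f : X → ℝ≥0∞}
    (hf : AEMeasurable f μ) : (∫⁻ x, f x ∂μ) ^ 2 ≤ μ Set.univ * ∫⁻ x, f x ^ 2 ∂μ := by
  have h := ENNReal.lintegral_mul_le_Lp_mul_Lq μ Real.HolderConjugate.two_two
    (aemeasurable_const (b := 1)) hf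
  have sqrt_sq (a : ℝ≥0∞) : (a ^ (2⁻¹ : ℝ)) ^ 2 = a := by
    rw [← ENNReal.rpow_natCast, ← ENNReal.rpow_mul]; norm_num
  simpa [mul_pow, sqrt_sq] using pow_le_pow_left₀ zero_le h 2

variable {F : Type*} [NormedAddCommGroup F]

theorem enorm_sq_le_two_mul_add_enorm_sub_sq (a b : F) :
    ‖a‖ₑ ^ 2 ≤ 2 * (‖b‖ₑ ^ 2 + ‖a - b‖ₑ ^ 2) := by
  have h := ENNReal.rpow_add_le_mul_rpow_add_rpow ‖b‖ₑ ‖a - b‖ₑ (p := 2) one_le_two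
  rw [show (2 : ℝ) - 1 = 1 by norm_num, ENNReal.rpow_one] at h
  calc ‖a‖ₑ ^ 2 = ‖b + (a - b)‖ₑ ^ 2 := by rw [add_sub_cancel]
    _ ≤ (‖b‖ₑ + ‖a - b‖ₑ) ^ 2 := by gcongr; exact enorm_add_le _ _
    _ ≤ 2 * (‖b‖ₑ ^ 2 + ‖a - b‖ₑ ^ 2) := by simpa using h

variable {X : Type*} [MeasurableSpace X] {μ : Measure X}

theorem lintegral_enorm_sq_le_two_mul (f : X → F) {g : X → F} (hg : AEStronglyMeasurable g μ) :
    ∫⁻ x, ‖f x‖ₑ ^ 2 ∂μ ≤ 2 * ((∫⁻ x, ‖g x‖ₑ ^ 2 ∂μ) + ∫⁻ x, ‖f x - g x‖ₑ ^ 2 ∂μ) := by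
  rw [← lintegral_add_left' (hg.enorm.pow_const 2),
    ← lintegral_const_mul' _ _ ENNReal.ofNat_ne_top]
  exact lintegral_mono fun x => enorm_sq_le_two_mul_add_enorm_sub_sq (f x) (g x)

variable [NormedSpace ℝ F] {E : Type*} [NormedAddCommGroup E] [NormedSpace ℝ E] {w : E → F}

theorem hasDerivAt_comp_add_smul (hw : ContDiff ℝ 1 w) (x v : E) (t : ℝ) :
    HasDerivAt (fun t : ℝ => w (x + t • v)) (fderiv ℝ w (x + t • v) v) t := by
  have h : HasDerivAt (fun t : ℝ => x + t • v) v t := by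
    simpa using ((hasDerivAt_id t).smul_const v).const_add x
  exact (hw.differentiable one_ne_zero _).hasFDerivAt.comp_hasDerivAt t h

theorem continuous_fderiv_add_smul_apply (hw : ContDiff ℝ 1 w) (x v : E) :
    Continuous fun t : ℝ => fderiv ℝ w (x + t • v) v :=
  ((hw.continuous_fderiv one_ne_zero).comp (by fun_prop)).clm_apply continuous_const

theorem enorm_apply_sq_le (T : E →L[ℝ] F) (v : E) : ‖T v‖ₑ ^ 2 ≤ ‖v‖ₑ ^ 2 * ‖T‖ₑ ^ 2 := by
  rw [← mul_pow, mul_comm]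
  gcongr
  exact T.le_opENorm v

variable [CompleteSpace F] {f f' : ℝ → F}

theorem enorm_sub_sq_le_setLIntegral_deriv (hf : ∀ t, HasDerivAt f (f' t) t)
    (hf' : Continuous f') {a b : ℝ} (hab : a ≤ b) :
    ‖f b - f a‖ₑ ^ 2 ≤ ENNReal.ofReal (b - a) * ∫⁻ t in Set.Ioc a b, ‖f' t‖ₑ ^ 2 := by
  rw [← intervalIntegral.integral_eq_sub_of_hasDerivAt (fun t _ => hf t)
    (hf'.intervalIntegrable a b), intervalIntegral.integral_of_le hab]
  calc ‖∫ t in Set.Ioc a b, f' t‖ₑ ^ 2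
      ≤ (∫⁻ t in Set.Ioc a b, ‖f' t‖ₑ) ^ 2 := by
        gcongr; exact enorm_integral_le_lintegral_enorm _
    _ ≤ ENNReal.ofReal (b - a) * ∫⁻ t in Set.Ioc a b, ‖f' t‖ₑ ^ 2 := by
        simpa using lintegral_sq_le (μ := volume.restrict (Set.Ioc a b))
          hf'.enorm.measurable.aemeasurable

theorem ofReal_mul_enorm_sq_le_setLIntegral (hf : ∀ t, HasDerivAt f (f' t) t)
    (hf' : Continuous f') (h : ℝ) :
    ENNReal.ofReal h * ‖f 0‖ₑ ^ 2 ≤ 2 * ((∫⁻ t in Set.Ioc 0 h, ‖f t‖ₑ ^ 2) +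
      ENNReal.ofReal h ^ 2 * ∫⁻ t in Set.Ioc 0 h, ‖f' t‖ₑ ^ 2) := by
  set D := ∫⁻ t in Set.Ioc 0 h, ‖f' t‖ₑ ^ 2
  have increment_le : ∀ t ∈ Set.Ioc 0 h, ‖f 0 - f t‖ₑ ^ 2 ≤ ENNReal.ofReal h * D := by
    intro t ht
    rw [enorm_sub_rev]
    refine (enorm_sub_sq_le_setLIntegral_deriv hf hf' ht.1.le).trans ?_
    rw [sub_zero]
    exact mul_le_mul' (ENNReal.ofReal_le_ofReal ht.2)
      (lintegral_mono_set (Set.Ioc_subset_Ioc_right ht.2))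
  calc ENNReal.ofReal h * ‖f 0‖ₑ ^ 2
      = ∫⁻ _ in Set.Ioc 0 h, ‖f 0‖ₑ ^ 2 := by simp [mul_comm]
    _ ≤ ∫⁻ t in Set.Ioc 0 h, 2 * (‖f t‖ₑ ^ 2 + ENNReal.ofReal h * D) :=
        setLIntegral_mono' measurableSet_Ioc fun t ht =>
          (enorm_sq_le_two_mul_add_enorm_sub_sq (f 0) (f t)).trans <| by
            gcongr; exact increment_le t ht
    _ = 2 * ((∫⁻ t in Set.Ioc 0 h, ‖f t‖ₑ ^ 2) + ENNReal.ofReal h ^ 2 * D) := by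
        rw [lintegral_const_mul' _ _ ENNReal.ofNat_ne_top,
          lintegral_add_right _ measurable_const, setLIntegral_const, Real.volume_Ioc, sub_zero]
        ring

theorem enorm_sub_sq_le_lintegral_fderiv (hw : ContDiff ℝ 1 w) (x v : E) :
    ‖w (x + v) - w x‖ₑ ^ 2 ≤
      ∫⁻ t in Set.Ioc (0 : ℝ) 1, ‖v‖ₑ ^ 2 * ‖fderiv ℝ w (x + t • v)‖ₑ ^ 2 := by
  refine le_trans ?_ (lintegral_mono fun t => enorm_apply_sq_le _ v)
  simpa using enorm_sub_sq_le_setLIntegral_deriv (hasDerivAt_comp_add_smul hw x v)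
    (continuous_fderiv_add_smul_apply hw x v) zero_le_one

end Segments

section Translation

variable {E F : Type*} [NormedAddCommGroup E] [MeasurableSpace E] [BorelSpace E] {μ : Measure E}
  {A B : Set E}

theorem setLIntegral_comp_add_right_le [μ.IsAddRightInvariant] {h : E}
    (hAB : ∀ x ∈ A, x + h ∈ B) (f : E → ℝ≥0∞) :
    ∫⁻ x in A, f (x + h) ∂μ ≤ ∫⁻ x in B, f x ∂μ := by
  have hle : (μ.restrict A).map (MeasurableEquiv.addRight h) ≤ μ.restrict B := by
    refine Measure.le_iff.2 fun S hS => ?_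
    rw [MeasurableEquiv.map_apply, Measure.restrict_apply hS,
      Measure.restrict_apply (MeasurableEquiv.measurable _ hS),
      ← measure_preimage_add_right μ h (S ∩ B)]
    exact measure_mono fun x hx => ⟨hx.1, hAB x hx.2⟩
  calc ∫⁻ x in A, f (x + h) ∂μ
      = ∫⁻ x, f x ∂(μ.restrict A).map (MeasurableEquiv.addRight h) :=
        (lintegral_map_equiv f (MeasurableEquiv.addRight h)).symm
    _ ≤ ∫⁻ x in B, f x ∂μ := lintegral_mono' hle le_rfl

theorem setLIntegral_setLIntegral_le_setLIntegral_sub [SecondCountableTopology E] [SFinite μ]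
    [μ.IsAddRightInvariant] {D : Set E} (hA : MeasurableSet A)
    (hD : ∀ x ∈ A, ∀ y ∈ A, x - y ∈ D) {k : E → E → ℝ≥0∞} (hk : Measurable k.uncurry) :
    ∫⁻ y in A, ∫⁻ x in A, k y x ∂μ ∂μ ≤
      ∫⁻ h in D, ∫⁻ y in {y | y + h ∈ A} ∩ A, k y (y + h) ∂μ ∂μ := by
  set S : Set (E × E) := {p | p.1 + p.2 ∈ A}
  have hS : MeasurableSet S := hA.preimage (measurable_fst.add measurable_snd)
  set g : E × E → ℝ≥0∞ := S.indicator fun p => k p.1 (p.1 + p.2)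
  have hg : Measurable g :=
    (hk.comp (measurable_fst.prodMk (measurable_fst.add measurable_snd))).indicator hS
  calc ∫⁻ y in A, ∫⁻ x in A, k y x ∂μ ∂μ
      = ∫⁻ y in A, ∫⁻ x in A, g (y, x + -y) ∂μ ∂μ := by
        refine lintegral_congr fun y => setLIntegral_congr_fun hA fun x hx => ?_
        have hyx : y + (x + -y) = x := by abel
        simp [g, S, hyx, hx]
    _ ≤ ∫⁻ y in A, ∫⁻ h in D, g (y, h) ∂μ ∂μ := by
        refine setLIntegral_mono' hA fun y hy =>
          setLIntegral_comp_add_right_le (fun x hx => ?_) fun h => g (y, h)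
        simpa only [← sub_eq_add_neg] using hD x hx y hy
    _ = ∫⁻ h in D, ∫⁻ y in A, g (y, h) ∂μ ∂μ := lintegral_lintegral_swap hg.aemeasurable
    _ = ∫⁻ h in D, ∫⁻ y in {y | y + h ∈ A} ∩ A, k y (y + h) ∂μ ∂μ := by
        refine lintegral_congr fun h => ?_
        have hAh : MeasurableSet {y | y + h ∈ A} := hA.preimage (measurable_add_const h)
        rw [← Measure.restrict_restrict hAh, ← lintegral_indicator hAh]
        rfl

variable [NormedSpace ℝ E] [SFinite μ] [μ.IsAddRightInvariant]
  [NormedAddCommGroup F] [NormedSpace ℝ F] [CompleteSpace F] {w : E → F}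

theorem setLIntegral_enorm_translate_sub_sq_le (hw : ContDiff ℝ 1 w) {h : E}
    (hAB : ∀ x ∈ A, segment ℝ x (x + h) ⊆ B) :
    ∫⁻ x in A, ‖w (x + h) - w x‖ₑ ^ 2 ∂μ ≤ ‖h‖ₑ ^ 2 * ∫⁻ x in B, ‖fderiv ℝ w x‖ₑ ^ 2 ∂μ := by
  have hm : Measurable fun p : E × ℝ => ‖h‖ₑ ^ 2 * ‖fderiv ℝ w (p.1 + p.2 • h)‖ₑ ^ 2 :=
    .const_mul (((hw.continuous_fderiv one_ne_zero).comp
      (by fun_prop)).enorm.measurable.pow_const 2) _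
  calc ∫⁻ x in A, ‖w (x + h) - w x‖ₑ ^ 2 ∂μ
      ≤ ∫⁻ x in A, (∫⁻ t in Set.Ioc (0 : ℝ) 1, ‖h‖ₑ ^ 2 * ‖fderiv ℝ w (x + t • h)‖ₑ ^ 2) ∂μ :=
        lintegral_mono fun x => enorm_sub_sq_le_lintegral_fderiv hw x h
    _ = ∫⁻ t in Set.Ioc (0 : ℝ) 1, ∫⁻ x in A, ‖h‖ₑ ^ 2 * ‖fderiv ℝ w (x + t • h)‖ₑ ^ 2 ∂μ :=
        lintegral_lintegral_swap hm.aemeasurable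
    _ ≤ ∫⁻ _ in Set.Ioc (0 : ℝ) 1, (∫⁻ x in B, ‖h‖ₑ ^ 2 * ‖fderiv ℝ w x‖ₑ ^ 2 ∂μ) := by
        refine setLIntegral_mono' measurableSet_Ioc fun t ht => setLIntegral_comp_add_right_le
          (fun x hx => hAB x hx ?_) fun x => ‖h‖ₑ ^ 2 * ‖fderiv ℝ w x‖ₑ ^ 2
        rw [segment_eq_image']
        exact ⟨t, ⟨ht.1.le, ht.2⟩, by rw [add_sub_cancel_left]⟩
    _ = ‖h‖ₑ ^ 2 * ∫⁻ x in B, ‖fderiv ℝ w x‖ₑ ^ 2 ∂μ := by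
        rw [setLIntegral_const, Real.volume_Ioc,
          lintegral_const_mul' _ _ (ENNReal.pow_ne_top enorm_ne_top)]
        simp

theorem setLIntegral_setLIntegral_enorm_sub_sq_le_of_convex [SecondCountableTopology E]
    (hA : Convex ℝ A) (hAm : MeasurableSet A) {d : ℝ}
    (hd : ∀ x ∈ A, ∀ y ∈ A, ‖x - y‖ ≤ d) (hw : ContDiff ℝ 1 w) :
    ∫⁻ y in A, ∫⁻ x in A, ‖w x - w y‖ₑ ^ 2 ∂μ ∂μ ≤
      μ (Metric.closedBall 0 d) * ENNReal.ofReal d ^ 2 * ∫⁻ x in A, ‖fderiv ℝ w x‖ₑ ^ 2 ∂μ := by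
  have hwc := hw.continuous
  have hm : Measurable (Function.uncurry fun y x => ‖w x - w y‖ₑ ^ 2) :=
    (by fun_prop : Continuous fun p : E × E => w p.2 - w p.1).enorm.measurable.pow_const 2
  calc ∫⁻ y in A, ∫⁻ x in A, ‖w x - w y‖ₑ ^ 2 ∂μ ∂μ
      ≤ ∫⁻ h in Metric.closedBall 0 d,
          ∫⁻ y in {y | y + h ∈ A} ∩ A, ‖w (y + h) - w y‖ₑ ^ 2 ∂μ ∂μ :=
        setLIntegral_setLIntegral_le_setLIntegral_sub hAm
          (fun x hx y hy => mem_closedBall_zero_iff.2 (hd x hx y hy)) hm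
    _ ≤ ∫⁻ _ in Metric.closedBall 0 d,
          ENNReal.ofReal d ^ 2 * ∫⁻ x in A, ‖fderiv ℝ w x‖ₑ ^ 2 ∂μ ∂μ := by
        refine setLIntegral_mono' Metric.isClosed_closedBall.measurableSet fun h hh =>
          (setLIntegral_enorm_translate_sub_sq_le hw
            fun y hy => hA.segment_subset hy.2 hy.1).trans ?_
        gcongr
        rw [← ofReal_norm]
        exact ENNReal.ofReal_le_ofReal (mem_closedBall_zero_iff.1 hh)
    _ = _ := by rw [setLIntegral_const]; ring

end Translation
section EnergyControls

variable {E : Type*} [NormedAddCommGroup E] [NormedSpace ℝ E] [MeasurableSpace E]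
  {ρ ρ' μ μ' ν ν' : Measure E}

/-- The squared `L²(ν)` norm of `C¹` functions is controlled by their squared `L²(μ)` norm and
their Dirichlet energy with respect to `ρ`. Interior estimates, trace inequalities and the
Poincaré–Friedrichs inequality are all of this form. -/
def EnergyControls (ρ μ ν : Measure E) : Prop :=
  ∃ C : ℝ≥0, ∀ w : E → ℝ, ContDiff ℝ 1 w →
    ∫⁻ x, ‖w x‖ₑ ^ 2 ∂ν ≤ C * ((∫⁻ x, ‖w x‖ₑ ^ 2 ∂μ) + ∫⁻ x, ‖fderiv ℝ w x‖ₑ ^ 2 ∂ρ)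

/-- The Poincaré inequality: up to an additive constant, the squared `L²(ν)` norm of `C¹` functions
is controlled by their Dirichlet energy with respect to `ρ`. -/
def PoincareInequality (ρ ν : Measure E) : Prop :=
  ∃ C : ℝ≥0, ∀ w : E → ℝ, ContDiff ℝ 1 w → ∃ c : ℝ,
    ∫⁻ x, ‖w x - c‖ₑ ^ 2 ∂ν ≤ C * ∫⁻ x, ‖fderiv ℝ w x‖ₑ ^ 2 ∂ρ

namespace EnergyControls

theorem of_le_smul {c : ℝ≥0} (h : ν ≤ c • μ) : EnergyControls ρ μ ν := by
  refine ⟨c, fun w _ => (lintegral_mono' h le_rfl).trans ?_⟩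
  rw [lintegral_smul_measure]
  exact mul_le_mul_right le_self_add (c : ℝ≥0∞)

theorem of_le (h : ν ≤ μ) : EnergyControls ρ μ ν :=
  of_le_smul (c := 1) (by rwa [one_smul])

theorem trans (h : EnergyControls ρ μ ν) (h' : EnergyControls ρ ν ν') :
    EnergyControls ρ μ ν' := by
  obtain ⟨C, hC⟩ := h
  obtain ⟨C', hC'⟩ := h'
  refine ⟨C' * (C + 1), fun w hw => (hC' w hw).trans ?_⟩
  push_cast
  rw [mul_assoc, add_mul, one_mul]
  gcongr
  exacts [hC w hw, le_add_self]

theorem mono (h : EnergyControls ρ μ ν) (hν : ν' ≤ ν) : EnergyControls ρ μ ν' :=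
  h.trans (of_le hν)

theorem add (h : EnergyControls ρ μ ν) (h' : EnergyControls ρ μ ν') :
    EnergyControls ρ μ (ν + ν') := by
  obtain ⟨C, hC⟩ := h
  obtain ⟨C', hC'⟩ := h'
  refine ⟨C + C', fun w hw => ?_⟩
  rw [lintegral_add_measure, ENNReal.coe_add, add_mul]
  exact add_le_add (hC w hw) (hC' w hw)

theorem of_isCompact {K : Set E} (hK : IsCompact K)
    (h : ∀ x ∈ K, ∃ U ∈ 𝓝 x, EnergyControls ρ μ (ν.restrict U)) :
    EnergyControls ρ μ (ν.restrict K) := by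
  refine hK.induction_on (p := fun S => EnergyControls ρ μ (ν.restrict S)) ?_ ?_ ?_ ?_
  · rw [Measure.restrict_empty]
    exact of_le (Measure.zero_le μ)
  · exact fun S T hST hT => hT.mono (Measure.restrict_mono hST le_rfl)
  · exact fun S T hS hT => (hS.add hT).mono (Measure.restrict_union_le S T)
  · intro x hx
    obtain ⟨U, hU, hUν⟩ := h x hx
    exact ⟨U, mem_nhdsWithin_of_mem_nhds hU, hUν⟩

theorem poincareInequality (h : EnergyControls ρ μ ν) (hμ : PoincareInequality ρ μ) :
    PoincareInequality ρ ν := by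
  obtain ⟨C, hC⟩ := h
  obtain ⟨P, hP⟩ := hμ
  refine ⟨C * (P + 1), fun w hw => ?_⟩
  obtain ⟨c, hc⟩ := hP w hw
  refine ⟨c, (hC _ (hw.sub contDiff_const)).trans ?_⟩
  push_cast
  rw [mul_assoc, add_mul, one_mul]
  simp only [fderiv_sub_const]
  gcongr

variable [BorelSpace E]

theorem translate [SFinite ρ] [ρ.IsAddRightInvariant] {Ω A B : Set E} {h : E}
    (hAB : ∀ x ∈ A, x + h ∈ B) (hAΩ : ∀ x ∈ A, segment ℝ x (x + h) ⊆ Ω) :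
    EnergyControls (ρ.restrict Ω) (ρ.restrict B) (ρ.restrict A) := by
  refine ⟨2 * (1 + ‖h‖₊ ^ 2), fun w hw => ?_⟩
  have hwc := hw.continuous
  calc ∫⁻ x in A, ‖w x‖ₑ ^ 2 ∂ρ
      ≤ 2 * ((∫⁻ x in A, ‖w (x + h)‖ₑ ^ 2 ∂ρ) + ∫⁻ x in A, ‖w x - w (x + h)‖ₑ ^ 2 ∂ρ) :=
        lintegral_enorm_sq_le_two_mul w
          (by fun_prop : Continuous fun x => w (x + h)).aestronglyMeasurable
    _ ≤ 2 * ((∫⁻ x in B, ‖w x‖ₑ ^ 2 ∂ρ) + ‖h‖ₑ ^ 2 * ∫⁻ x in Ω, ‖fderiv ℝ w x‖ₑ ^ 2 ∂ρ) := by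
        simp only [enorm_sub_rev (w _) (w (_ + h))]
        exact mul_le_mul_right (add_le_add
          (setLIntegral_comp_add_right_le hAB fun x => ‖w x‖ₑ ^ 2)
          (setLIntegral_enorm_translate_sub_sq_le hw hAΩ)) 2
    _ ≤ 2 * ((1 + ‖h‖ₑ ^ 2) * (∫⁻ x in B, ‖w x‖ₑ ^ 2 ∂ρ) +
          (1 + ‖h‖ₑ ^ 2) * ∫⁻ x in Ω, ‖fderiv ℝ w x‖ₑ ^ 2 ∂ρ) := by
        gcongr
        exacts [le_mul_of_one_le_left' le_self_add, le_add_self]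
    _ = _ := by rw [← mul_add, ← mul_assoc]; push_cast; rfl

end EnergyControls

theorem PoincareInequality.mono_left (h : PoincareInequality ρ ν) (hρ : ρ ≤ ρ') :
    PoincareInequality ρ' ν := by
  obtain ⟨C, hC⟩ := h
  refine ⟨C, fun w hw => (hC w hw).imp fun c hc => hc.trans ?_⟩
  gcongr

theorem PoincareInequality.energyControls [BorelSpace E] [IsFiniteMeasure ν]
    (h : PoincareInequality ρ ν) (hμν : μ ≤ ν) (hμ : μ ≠ 0) : EnergyControls ρ μ ν := by
  obtain ⟨C, hC⟩ := h
  have hμ0 : μ Set.univ ≠ 0 := mt Measure.measure_univ_eq_zero.1 hμ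
  have hμtop : μ Set.univ ≠ ⊤ := ((hμν Set.univ).trans_lt (measure_lt_top ν _)).ne
  set m : ℝ≥0∞ := ν Set.univ / μ Set.univ
  have hm : m ≠ ⊤ := ENNReal.div_ne_top (measure_ne_top ν _) hμ0
  refine ⟨2 * C + 4 * m.toNNReal * (1 + C), fun w hw => ?_⟩
  obtain ⟨c, hc⟩ := hC w hw
  set G := ∫⁻ x, ‖fderiv ℝ w x‖ₑ ^ 2 ∂ρ
  set W := ∫⁻ x, ‖w x‖ₑ ^ 2 ∂μ
  have const_le : ‖c‖ₑ ^ 2 * μ Set.univ ≤ 2 * (W + C * G) := by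
    calc ‖c‖ₑ ^ 2 * μ Set.univ = ∫⁻ _, ‖c‖ₑ ^ 2 ∂μ := (lintegral_const _).symm
      _ ≤ 2 * (W + ∫⁻ x, ‖c - w x‖ₑ ^ 2 ∂μ) :=
          lintegral_enorm_sq_le_two_mul _ hw.continuous.aestronglyMeasurable
      _ ≤ 2 * (W + C * G) := by
          simp only [enorm_sub_rev c]
          gcongr
          exact (lintegral_mono' hμν le_rfl).trans hc
  calc ∫⁻ x, ‖w x‖ₑ ^ 2 ∂ν
      ≤ 2 * ((∫⁻ _, ‖c‖ₑ ^ 2 ∂ν) + ∫⁻ x, ‖w x - c‖ₑ ^ 2 ∂ν) :=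
        lintegral_enorm_sq_le_two_mul w aestronglyMeasurable_const
    _ = 2 * (‖c‖ₑ ^ 2 * μ Set.univ * m + ∫⁻ x, ‖w x - c‖ₑ ^ 2 ∂ν) := by
        rw [lintegral_const, mul_assoc, ENNReal.mul_div_cancel hμ0 hμtop]
    _ ≤ 2 * (2 * (W + C * G) * m + C * G) := by gcongr
    _ = (4 * m) * W + (2 * C + 4 * m * C) * G := by ring
    _ ≤ (2 * C + 4 * m * (1 + C)) * W + (2 * C + 4 * m * (1 + C)) * G := by
        gcongr
        · exact (le_mul_of_one_le_right' le_self_add).trans le_add_self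
        · exact le_add_self
    _ = _ := by push_cast; rw [ENNReal.coe_toNNReal hm]; ring

end EnergyControls

section Domains

variable {E : Type*} [NormedAddCommGroup E] [NormedSpace ℝ E] [FiniteDimensional ℝ E]
  [MeasurableSpace E] [BorelSpace E] {μ : Measure E} [μ.IsAddHaarMeasure]

theorem poincareInequality_of_convex {A : Set E} (hA : Convex ℝ A) (hAm : MeasurableSet A)
    (hAb : Bornology.IsBounded A) (hA0 : μ A ≠ 0) :
    PoincareInequality (μ.restrict A) (μ.restrict A) := by
  obtain ⟨d, hd⟩ := Metric.isBounded_iff.1 hAb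
  simp only [dist_eq_norm] at hd
  have hA_top : μ A ≠ ⊤ := hAb.measure_lt_top.ne
  set P : ℝ≥0∞ := μ (Metric.closedBall 0 d) * ENNReal.ofReal d ^ 2 / μ A
  have hP : P ≠ ⊤ := ENNReal.div_ne_top
    (ENNReal.mul_ne_top measure_closedBall_lt_top.ne (by finiteness)) hA0
  refine ⟨P.toNNReal, fun w hw => ?_⟩
  have hwc := hw.continuous
  have hm : Measurable fun p : E × E => ‖w p.2 - w p.1‖ₑ ^ 2 :=
    (by fun_prop : Continuous fun p : E × E => w p.2 - w p.1).enorm.measurable.pow_const 2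
  obtain ⟨y, -, hy⟩ := exists_le_setLAverage hA0 hA_top
    (f := fun y => ∫⁻ x in A, ‖w x - w y‖ₑ ^ 2 ∂μ) hm.lintegral_prod_right'.aemeasurable
  refine ⟨w y, hy.trans ?_⟩
  rw [ENNReal.coe_toNNReal hP, setLAverage_eq, ← ENNReal.mul_div_right_comm]
  gcongr
  exact setLIntegral_setLIntegral_enorm_sub_sq_le_of_convex hA hAm
    (fun x hx y hy => hd hx hy) hw

theorem exists_nhds_energyControls_ball {Ω : Set E} (hΩ : IsOpen Ω) (hc : IsPreconnected Ω)
    {x₀ : E} {r : ℝ} (hr : 0 < r) (hx₀ : x₀ ∈ Ω) {x : E} (hx : x ∈ Ω) :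
    ∃ U ∈ 𝓝 x, EnergyControls (μ.restrict Ω) (μ.restrict (Metric.ball x₀ r)) (μ.restrict U) := by
  set S : Set E := {x | ∃ U ∈ 𝓝 x,
    EnergyControls (μ.restrict Ω) (μ.restrict (Metric.ball x₀ r)) (μ.restrict U)}
  have hS : IsOpen S := isOpen_iff_mem_nhds.2 fun y ⟨U, hU, hUc⟩ => by
    filter_upwards [eventually_mem_nhds_iff.2 hU] with z hz using ⟨U, hz, hUc⟩
  have hx₀S : x₀ ∈ S := ⟨_, Metric.ball_mem_nhds x₀ hr, .of_le le_rfl⟩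
  refine hc.subset_of_closure_inter_subset hS ⟨x₀, hx₀, hx₀S⟩ ?_ hx
  rintro y ⟨hyS, hyΩ⟩
  obtain ⟨δ, hδ, hball⟩ := Metric.isOpen_iff.1 hΩ y hyΩ
  obtain ⟨z, ⟨U, hU, hUc⟩, hyz⟩ := Metric.mem_closure_iff.1 hyS (δ / 2) (half_pos hδ)
  obtain ⟨s, hs, hsU⟩ := Metric.mem_nhds_iff.1 hU
  refine ⟨Metric.ball y (min s (δ / 2)), Metric.ball_mem_nhds y (by positivity), hUc.trans
    (.translate (h := z - y) (fun p hp => hsU ?_) fun p hp => ?_)⟩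
  · rw [Metric.mem_ball, dist_eq_norm] at hp ⊢
    rw [show p + (z - y) - z = p - y by abel]
    exact hp.trans_le (min_le_left _ _)
  · rw [Metric.mem_ball, lt_min_iff, dist_eq_norm] at hp
    rw [dist_comm, dist_eq_norm] at hyz
    refine ((convex_ball y δ).segment_subset ?_ ?_).trans hball
    · rw [Metric.mem_ball, dist_eq_norm]; linarith
    · rw [Metric.mem_ball, dist_eq_norm, show p + (z - y) - y = (p - y) + (z - y) by abel]
      linarith [norm_add_le (p - y) (z - y)]

end Domains
theorem hausdorffMeasure_restrict_le_smul_map {X Y : Type*} [EMetricSpace X] [MeasurableSpace X]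
    [BorelSpace X] [EMetricSpace Y] [MeasurableSpace Y] [BorelSpace Y] {Ψ : X → Y} {L : ℝ≥0}
    (hΨ : LipschitzWith L Ψ) {d : ℝ} (hd : 0 ≤ d) {I : Set X} {S : Set Y} (hS : S ⊆ Ψ '' I) :
    (Measure.hausdorffMeasure d).restrict S ≤
      (L : ℝ≥0∞) ^ d • ((Measure.hausdorffMeasure d).restrict I).map Ψ := by
  have hΨm : Measurable Ψ := hΨ.continuous.measurable
  refine Measure.le_iff.2 fun A hA => ?_
  rw [Measure.restrict_apply hA, Measure.smul_apply, Measure.map_apply hΨm hA,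
    Measure.restrict_apply (hΨm hA)]
  have hsub : A ∩ S ⊆ Ψ '' (Ψ ⁻¹' A ∩ I) := by
    rintro y ⟨hyA, hyS⟩
    obtain ⟨s, hs, rfl⟩ := hS hyS
    exact ⟨s, ⟨hyA, hs⟩, rfl⟩
  exact (measure_mono hsub).trans (hΨ.hausdorffMeasure_image_le hd _)

section Chart

variable {Ω : Set Plane} {x : Plane} {e : Plane ≃ₗᵢ[ℝ] Plane} {γ : ℝ → ℝ} {K : ℝ≥0} {r : ℝ}

/-- The vertical direction of the orthonormal coordinates `e`. -/
def up (e : Plane ≃ₗᵢ[ℝ] Plane) : Plane := e.symm !₂[0, 1]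

theorem norm_up (e : Plane ≃ₗᵢ[ℝ] Plane) : ‖up e‖ = 1 := by
  simp [up, EuclideanSpace.norm_eq]

theorem apply_add_smul_up_zero (e : Plane ≃ₗᵢ[ℝ] Plane) (y : Plane) (t : ℝ) :
    e (y + t • up e) 0 = e y 0 := by
  simp [up]

theorem apply_add_smul_up_one (e : Plane ≃ₗᵢ[ℝ] Plane) (y : Plane) (t : ℝ) :
    e (y + t • up e) 1 = e y 1 + t := by
  simp [up]

theorem dist_add_smul_up_le (e : Plane ≃ₗᵢ[ℝ] Plane) (x y : Plane) (t : ℝ) :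
    dist (y + t • up e) x ≤ |t| + dist y x := by
  refine (dist_triangle _ y _).trans_eq ?_
  rw [dist_self_add_left, norm_smul, norm_up, mul_one, Real.norm_eq_abs]

/-- The point of the graph of `γ` above the abscissa `s`, in the orthonormal coordinates `e`. -/
def graphMap (e : Plane ≃ₗᵢ[ℝ] Plane) (γ : ℝ → ℝ) (s : ℝ) : Plane := e.symm !₂[s, γ s]

theorem lipschitzWith_graphMap (e : Plane ≃ₗᵢ[ℝ] Plane) (hγ : LipschitzWith K γ) :
    LipschitzWith (1 + K) (graphMap e γ) := by
  refine LipschitzWith.of_dist_le_mul fun s t => ?_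
  have hdist : dist (graphMap e γ s) (graphMap e γ t) = √((s - t) ^ 2 + (γ s - γ t) ^ 2) := by
    rw [graphMap, graphMap, e.symm.dist_map, EuclideanSpace.dist_eq]
    simp [Real.dist_eq, sq_abs]
  have hγst := hγ.dist_le_mul s t
  rw [Real.dist_eq, Real.dist_eq] at hγst
  rw [hdist, Real.dist_eq, Real.sqrt_le_iff, ← sq_abs (s - t), ← sq_abs (γ s - γ t)]
  push_cast
  refine ⟨by positivity, ?_⟩
  nlinarith [pow_le_pow_left₀ (abs_nonneg _) hγst 2, mul_nonneg K.2 (sq_nonneg |s - t|)]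

/-- Lebesgue measure is preserved because the coordinates are those of `e` followed by the vertical
shear along `γ`. -/
theorem measurePreserving_graphMap_add_smul_up (e : Plane ≃ₗᵢ[ℝ] Plane) (hγ : Continuous γ) :
    MeasurePreserving (fun p : ℝ × ℝ => graphMap e γ p.1 + p.2 • up e) := by
  have shear : MeasurePreserving (fun p : ℝ × ℝ => (p.1, γ p.1 + p.2)) :=
    (MeasurePreserving.id volume).skew_product (g := fun a b => γ a + b)
      (by fun_prop) (Eventually.of_forall fun a => map_add_left_eq_self volume (γ a))
  have toPlane := (EuclideanSpace.volume_preserving_symm_measurableEquiv_toLp (Fin 2)).symm.comp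
    (volume_preserving_finTwoArrow ℝ).symm
  convert e.symm.measurePreserving.comp (toPlane.comp shear) using 2 with p
  have hp : (!₂[p.1, γ p.1] : Plane) + p.2 • !₂[0, 1] = !₂[p.1, γ p.1 + p.2] := by
    ext i; fin_cases i <;> simp
  rw [graphMap, up, ← map_smul, ← map_add, hp]
  rfl

theorem setLIntegral_setLIntegral_graphMap_le (hΩ : MeasurableSet Ω) (hγ : Continuous γ)
    {I J : Set ℝ} (hIJ : ∀ s ∈ I, ∀ t ∈ J, graphMap e γ s + t • up e ∈ Ω) {f : Plane → ℝ≥0∞}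
    (hf : Measurable f) :
    ∫⁻ s in I, ∫⁻ t in J, f (graphMap e γ s + t • up e) ≤ ∫⁻ x in Ω, f x := by
  have hmp := measurePreserving_graphMap_add_smul_up e hγ
  rw [lintegral_lintegral (f := fun s t => f (graphMap e γ s + t • up e))
      (hf.comp hmp.measurable).aemeasurable,
    Measure.prod_restrict, ← hmp.setLIntegral_comp_preimage hΩ hf]
  exact lintegral_mono_set fun p hp => hIJ p.1 hp.1 p.2 hp.2

theorem ofReal_mul_enorm_graphMap_sq_le {w : Plane → ℝ} (hw : ContDiff ℝ 1 w) (h s : ℝ) :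
    ENNReal.ofReal h * ‖w (graphMap e γ s)‖ₑ ^ 2 ≤
      2 * ((∫⁻ t in Set.Ioc 0 h, ‖w (graphMap e γ s + t • up e)‖ₑ ^ 2) + ENNReal.ofReal h ^ 2 *
        ∫⁻ t in Set.Ioc 0 h, ‖fderiv ℝ w (graphMap e γ s + t • up e)‖ₑ ^ 2) := by
  have hup : ‖up e‖ₑ = 1 := by rw [← ofReal_norm, norm_up, ENNReal.ofReal_one]
  have on_segment := ofReal_mul_enorm_sq_le_setLIntegral
    (hasDerivAt_comp_add_smul hw (graphMap e γ s) (up e))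
    (continuous_fderiv_add_smul_apply hw _ _) h
  rw [zero_smul, add_zero] at on_segment
  refine on_segment.trans ?_
  gcongr with t
  exact (ContinuousLinearMap.le_opENorm _ _).trans_eq (by rw [hup, mul_one])

theorem energyControls_map_graphMap (hΩ : MeasurableSet Ω) (hγ : Continuous γ) {I : Set ℝ}
    {h : ℝ} (hh : 0 < h) (hIΩ : ∀ s ∈ I, ∀ t ∈ Set.Ioc 0 h, graphMap e γ s + t • up e ∈ Ω) :
    EnergyControls (volume.restrict Ω) (volume.restrict Ω)
      ((volume.restrict I).map (graphMap e γ)) := by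
  set H : ℝ≥0 := h.toNNReal
  have hH : H ≠ 0 := (Real.toNNReal_pos.2 hh).ne'
  have hgraph : Continuous (graphMap e γ) := by unfold graphMap; fun_prop
  refine ⟨H⁻¹ * (2 * (1 + H ^ 2)), fun w hw => ?_⟩
  have hm : Measurable fun x => ‖w x‖ₑ ^ 2 := hw.continuous.enorm.measurable.pow_const 2
  have hm' : Measurable fun x => ‖fderiv ℝ w x‖ₑ ^ 2 :=
    (hw.continuous_fderiv one_ne_zero).enorm.measurable.pow_const 2
  have hfibre : Measurable fun s => ∫⁻ t in Set.Ioc 0 h, ‖w (graphMap e γ s + t • up e)‖ₑ ^ 2 :=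
    (hm.comp (measurePreserving_graphMap_add_smul_up e hγ).measurable).lintegral_prod_right'
  rw [lintegral_map hm hgraph.measurable, ENNReal.coe_mul, ENNReal.coe_inv hH, mul_assoc,
    ← ENNReal.mul_le_iff_le_inv (ENNReal.coe_ne_zero.2 hH) ENNReal.coe_ne_top,
    ← lintegral_const_mul' _ _ ENNReal.coe_ne_top]
  calc ∫⁻ s in I, H * ‖w (graphMap e γ s)‖ₑ ^ 2
      ≤ ∫⁻ s in I, 2 * ((∫⁻ t in Set.Ioc 0 h, ‖w (graphMap e γ s + t • up e)‖ₑ ^ 2) +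
          (H : ℝ≥0∞) ^ 2 *
            ∫⁻ t in Set.Ioc 0 h, ‖fderiv ℝ w (graphMap e γ s + t • up e)‖ₑ ^ 2) :=
        lintegral_mono fun s => ofReal_mul_enorm_graphMap_sq_le hw h s
    _ ≤ 2 * ((∫⁻ x in Ω, ‖w x‖ₑ ^ 2) + H ^ 2 * ∫⁻ x in Ω, ‖fderiv ℝ w x‖ₑ ^ 2) := by
        rw [lintegral_const_mul' _ _ ENNReal.ofNat_ne_top, lintegral_add_left hfibre,
          lintegral_const_mul' _ _ (by finiteness)]
        exact mul_le_mul_right (add_le_add (setLIntegral_setLIntegral_graphMap_le hΩ hγ hIΩ hm)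
          (mul_le_mul_right (setLIntegral_setLIntegral_graphMap_le hΩ hγ hIΩ hm') _)) 2
    _ ≤ 2 * ((1 + H ^ 2) * (∫⁻ x in Ω, ‖w x‖ₑ ^ 2) +
          (1 + H ^ 2) * ∫⁻ x in Ω, ‖fderiv ℝ w x‖ₑ ^ 2) := by
        gcongr
        exacts [le_mul_of_one_le_left' le_self_add, le_add_self]
    _ = _ := by rw [← mul_add, ← mul_assoc]; push_cast; rfl

theorem eq_graphMap_of_mem_frontier (hΩ : IsOpen Ω) (hγ : Continuous γ)
    (h : ∀ y ∈ Metric.ball x r, y ∈ Ω ↔ γ (e y 0) < e y 1) {y : Plane}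
    (hy : y ∈ Metric.ball x r) (hyf : y ∈ frontier Ω) : y = graphMap e γ (e y 0) := by
  have not_above : e y 1 ≤ γ (e y 0) := by
    rw [hΩ.frontier_eq] at hyf
    exact not_lt.1 fun hlt => hyf.2 ((h y hy).2 hlt)
  have not_below : γ (e y 0) ≤ e y 1 := by
    by_contra! hlt
    have hopen : IsOpen {z : Plane | e z 1 < γ (e z 0)} := isOpen_lt (by fun_prop) (by fun_prop)
    obtain ⟨z, hz, hzΩ⟩ := mem_closure_iff_nhds.1 (frontier_subset_closure hyf) _
      (inter_mem (hopen.mem_nhds hlt) (Metric.isOpen_ball.mem_nhds hy))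
    exact lt_asymm hz.1 ((h z hz.2).1 hzΩ)
  rw [graphMap, LinearIsometryEquiv.eq_symm_apply]
  ext i
  fin_cases i
  · simp
  · simpa using le_antisymm not_above not_below

theorem exists_isCompact_energyControls (hγ : Continuous γ) (hr : 0 < r)
    (h : ∀ y ∈ Metric.ball x r, y ∈ Ω ↔ γ (e y 0) < e y 1) :
    ∃ S ⊆ Ω, IsCompact S ∧ EnergyControls (volume.restrict Ω) (volume.restrict S)
      (volume.restrict (Metric.ball x (r / 4) ∩ Ω)) := by
  have hclosed : IsClosed {y : Plane | γ (e y 0) + r / 2 ≤ e y 1} :=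
    isClosed_le (by fun_prop) (by fun_prop)
  have lift_mem : ∀ y ∈ Metric.ball x (r / 4) ∩ Ω, ∀ t ∈ Set.Icc 0 (r / 2),
      dist (y + t • up e) x ≤ 3 / 4 * r ∧ γ (e (y + t • up e) 0) + t < e (y + t • up e) 1 := by
    rintro y ⟨hy, hyΩ⟩ t ht
    have hyr : y ∈ Metric.ball x r := Metric.ball_subset_ball (by linarith) hy
    rw [apply_add_smul_up_zero, apply_add_smul_up_one]
    refine ⟨?_, by linarith [(h y hyr).1 hyΩ]⟩
    have := dist_add_smul_up_le e x y t
    rw [abs_of_nonneg ht.1] at this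
    linarith [ht.2, Metric.mem_ball.1 hy]
  refine ⟨Metric.closedBall x (3 / 4 * r) ∩ {y | γ (e y 0) + r / 2 ≤ e y 1}, ?_,
    (isCompact_closedBall x _).inter_right hclosed,
    .translate (h := (r / 2) • up e) (fun y hy => ?_) fun y hy => ?_⟩
  · rintro y ⟨hy, hyγ : γ (e y 0) + r / 2 ≤ e y 1⟩
    refine (h y (Metric.mem_ball.2 ((Metric.mem_closedBall.1 hy).trans_lt (by linarith)))).2 ?_
    linarith
  · obtain ⟨hdist, hlt⟩ := lift_mem y hy (r / 2) ⟨by linarith, le_rfl⟩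
    exact ⟨hdist, hlt.le⟩
  · rw [segment_eq_image', add_sub_cancel_left]
    rintro _ ⟨τ, hτ, rfl⟩
    dsimp only
    rw [smul_smul]
    have hτr : 0 ≤ τ * (r / 2) := mul_nonneg hτ.1 (by linarith)
    obtain ⟨hdist, hlt⟩ := lift_mem y hy (τ * (r / 2)) ⟨hτr, by nlinarith [hτ.2]⟩
    exact (h _ (Metric.mem_ball.2 (hdist.trans_lt (by linarith)))).2 (by linarith)

theorem exists_nhds_energyControls_surf (hΩ : IsOpen Ω) (hx : x ∈ frontier Ω)
    (hγ : LipschitzWith K γ) (hr : 0 < r)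
    (h : ∀ y ∈ Metric.ball x r, y ∈ Ω ↔ γ (e y 0) < e y 1) :
    ∃ U ∈ 𝓝 x, EnergyControls (volume.restrict Ω) (volume.restrict Ω) ((surf Ω).restrict U) := by
  have hLip := lipschitzWith_graphMap e hγ
  have hxγ := eq_graphMap_of_mem_frontier hΩ hγ.continuous h (Metric.mem_ball_self hr) hx
  obtain ⟨δ, hδ, hδr⟩ := Metric.continuous_iff.1 hLip.continuous (e x 0) (r / 2) (half_pos hr)
  rw [← hxγ] at hδr
  have strip_subset : ∀ s ∈ Metric.ball (e x 0) δ, ∀ t ∈ Set.Ioc 0 (r / 2),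
      graphMap e γ s + t • up e ∈ Ω := by
    intro s hs t ht
    rw [h, apply_add_smul_up_zero, apply_add_smul_up_one]
    · simpa [graphMap] using ht.1
    · rw [Metric.mem_ball]
      have := dist_add_smul_up_le e x (graphMap e γ s) t
      rw [abs_of_pos ht.1] at this
      linarith [hδr s hs, ht.2]
  set U := Metric.ball x (min δ r)
  have subset_graph : U ∩ frontier Ω ⊆ graphMap e γ '' Metric.ball (e x 0) δ := by
    rintro y ⟨hy, hyf⟩
    rw [Metric.mem_ball, lt_min_iff] at hy
    refine ⟨e y 0, ?_, (eq_graphMap_of_mem_frontier hΩ hγ.continuous h hy.2 hyf).symm⟩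
    calc dist (e y 0) (e x 0) = ‖e (y - x) 0‖ := by rw [dist_eq_norm]; simp
      _ ≤ ‖e (y - x)‖ := PiLp.norm_apply_le _ _
      _ = dist y x := by rw [e.norm_map, dist_eq_norm]
      _ < δ := hy.1
  have surf_le : (surf Ω).restrict U ≤
      (1 + K) • (volume.restrict (Metric.ball (e x 0) δ)).map (graphMap e γ) := by
    have := hausdorffMeasure_restrict_le_smul_map hLip zero_le_one subset_graph
    rw [ENNReal.rpow_one, hausdorffMeasure_real] at this
    rwa [surf, Measure.restrict_restrict measurableSet_ball]
  exact ⟨U, Metric.ball_mem_nhds x (lt_min hδ hr),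
    (energyControls_map_graphMap hΩ.measurableSet hγ.continuous (half_pos hr) strip_subset).trans
      (.of_le_smul surf_le)⟩

end Chart

namespace IsLipschitzDomain

variable {Ω : Set Plane} (hΩ : IsLipschitzDomain Ω)

include hΩ

theorem energyControls_ball {x₀ : Plane} {r : ℝ} (hr : 0 < r) (hx₀ : x₀ ∈ Ω) :
    EnergyControls (volume.restrict Ω) (volume.restrict (Metric.ball x₀ r))
      (volume.restrict Ω) := by
  have near_interior : ∀ x ∈ Ω, ∃ U ∈ 𝓝 x, EnergyControls (volume.restrict Ω)
      (volume.restrict (Metric.ball x₀ r)) (volume.restrict U) := fun x hx =>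
    exists_nhds_energyControls_ball hΩ.isOpen hΩ.isConnected.isPreconnected hr hx₀ hx
  have near_boundary : ∀ x ∈ frontier Ω, ∃ U ∈ 𝓝 x, EnergyControls (volume.restrict Ω)
      (volume.restrict (Metric.ball x₀ r)) (volume.restrict (U ∩ Ω)) := by
    intro x hx
    obtain ⟨e, γ, K, ρ, hγ, hρ, h⟩ := hΩ.chart x hx
    obtain ⟨S, hSΩ, hS, hSc⟩ := exists_isCompact_energyControls hγ.continuous hρ h
    exact ⟨_, Metric.ball_mem_nhds x (by linarith),
      (EnergyControls.of_isCompact hS fun y hy => near_interior y (hSΩ hy)).trans hSc⟩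
  have on_closure : EnergyControls (volume.restrict Ω) (volume.restrict (Metric.ball x₀ r))
      ((volume.restrict Ω).restrict (closure Ω)) := by
    refine .of_isCompact hΩ.isBounded.isCompact_closure fun x hx => ?_
    simp only [Measure.restrict_restrict' hΩ.isOpen.measurableSet]
    by_cases hxΩ : x ∈ Ω
    · obtain ⟨U, hU, hUc⟩ := near_interior x hxΩ
      exact ⟨U, hU, hUc.mono (Measure.restrict_mono Set.inter_subset_left le_rfl)⟩
    · exact near_boundary x (hΩ.isOpen.frontier_eq ▸ ⟨hx, hxΩ⟩)
  rwa [Measure.restrict_restrict' hΩ.isOpen.measurableSet,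
    Set.inter_eq_right.2 subset_closure] at on_closure

theorem energyControls_surf :
    EnergyControls (volume.restrict Ω) (volume.restrict Ω) (surf Ω) := by
  have hcompact : IsCompact (frontier Ω) :=
    hΩ.isBounded.isCompact_closure.of_isClosed_subset isClosed_frontier frontier_subset_closure
  have hsurf : (surf Ω).restrict (frontier Ω) = surf Ω := by
    rw [surf, Measure.restrict_restrict isClosed_frontier.measurableSet, Set.inter_self]
  rw [← hsurf]
  refine .of_isCompact hcompact fun x hx => ?_
  obtain ⟨e, γ, K, r, hγ, hr, h⟩ := hΩ.chart x hx
  exact exists_nhds_energyControls_surf hΩ.isOpen hx hγ hr h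

theorem isFiniteMeasure_restrict : IsFiniteMeasure (volume.restrict Ω) :=
  ⟨by simpa using hΩ.isBounded.measure_lt_top⟩

theorem isFiniteMeasure_surf : IsFiniteMeasure (surf Ω) := by
  have := hΩ.isFiniteMeasure_restrict
  obtain ⟨C, hC⟩ := hΩ.energyControls_surf
  have hle : surf Ω Set.univ ≤ C * volume.restrict Ω Set.univ := by
    simpa [fderiv_fun_const, enorm_eq_nnnorm] using hC (fun _ => 1) contDiff_const
  exact ⟨hle.trans_lt (by finiteness)⟩

theorem poincareInequality :
    PoincareInequality (volume.restrict Ω) (volume.restrict Ω + surf Ω) := by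
  obtain ⟨x₀, hx₀⟩ := hΩ.isConnected.nonempty
  obtain ⟨r, hr, hball⟩ := Metric.isOpen_iff.1 hΩ.isOpen x₀ hx₀
  have on_ball : PoincareInequality (volume.restrict Ω) (volume.restrict (Metric.ball x₀ r)) :=
    (poincareInequality_of_convex (convex_ball x₀ r) measurableSet_ball Metric.isBounded_ball
      (Metric.measure_ball_pos volume x₀ hr).ne').mono_left (Measure.restrict_mono hball le_rfl)
  have hΩball := hΩ.energyControls_ball hr hx₀
  exact (hΩball.add (hΩball.trans hΩ.energyControls_surf)).poincareInequality on_ball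

theorem friedrichs {Γ : Set Plane} (hΓ : 0 < surf Ω Γ) :
    EnergyControls (volume.restrict Ω) ((surf Ω).restrict Γ) (volume.restrict Ω + surf Ω) := by
  have := hΩ.isFiniteMeasure_restrict
  have := hΩ.isFiniteMeasure_surf
  exact hΩ.poincareInequality.energyControls
    (Measure.restrict_le_self.trans (Measure.le_add_left le_rfl))
    (Measure.restrict_eq_zero.not.2 hΓ.ne')

end IsLipschitzDomain

section Gradient

variable {H : Type*} [NormedAddCommGroup H] [InnerProductSpace ℝ H] [CompleteSpace H] {v w : H → ℝ}

theorem gradient_add {x : H} (hv : DifferentiableAt ℝ v x) (hw : DifferentiableAt ℝ w x) :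
    gradient (v + w) x = gradient v x + gradient w x := by
  simp only [gradient, fderiv_add hv hw, map_add]

theorem gradient_const_smul {x : H} (hv : DifferentiableAt ℝ v x) (c : ℝ) :
    gradient (c • v) x = c • gradient v x := by
  simp [gradient, fderiv_const_smul hv]

theorem enorm_gradient (w : H → ℝ) (x : H) : ‖gradient w x‖ₑ = ‖fderiv ℝ w x‖ₑ :=
  (InnerProductSpace.toDual ℝ H).symm.enorm_map _

theorem continuous_gradient (hw : ContDiff ℝ 1 w) : Continuous (gradient w) :=
  (InnerProductSpace.toDual ℝ H).symm.continuous.comp (hw.continuous_fderiv one_ne_zero)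

theorem hasCompactSupport_gradient (hw : HasCompactSupport w) : HasCompactSupport (gradient w) :=
  (hw.fderiv ℝ).comp_left (map_zero (InnerProductSpace.toDual ℝ H).symm)

end Gradient

section Lp

variable {X E : Type*} [MeasurableSpace X] [NormedAddCommGroup E] {μ : Measure X}

theorem enorm_sq_eq_lintegral_of_ae_eq {f : Lp E 2 μ} {g : X → E} (h : f =ᵐ[μ] g) :
    ‖f‖ₑ ^ 2 = ∫⁻ x, ‖g x‖ₑ ^ 2 ∂μ := by
  rw [Lp.enorm_def, eLpNorm_congr_ae h]
  simpa using eLpNorm_nnreal_pow_eq_lintegral (f := g) (μ := μ) (p := 2) two_ne_zero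

theorem tendsto_Lp_iff_tendsto_eLpNorm_of_ae_eq {p : ℝ≥0∞} [Fact (1 ≤ p)] {ι : Type*}
    {l : Filter ι} {f : ι → Lp E p μ} {g : ι → X → E} (h : ∀ i, f i =ᵐ[μ] g i) (u : Lp E p μ) :
    Tendsto f l (𝓝 u) ↔ Tendsto (fun i => eLpNorm (fun x => g i x - u x) p μ) l (𝓝 0) := by
  rw [Lp.tendsto_Lp_iff_tendsto_eLpNorm']
  refine tendsto_congr fun i => eLpNorm_congr_ae ?_
  filter_upwards [h i] with x hx
  rw [Pi.sub_apply, hx]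

end Lp

section GraphSpace

variable {Ω ΓD : Set Plane}

/-- The space `L²(Ω) × L²(Ω; ℝ²) × L²(∂Ω)`, in which an element `u` of `H¹(Ω)` is represented by
the triple `(u, ∇u, u|∂Ω)`. -/
abbrev GraphSpace (Ω : Set Plane) : Type :=
  Lp ℝ 2 (volume.restrict Ω) × Lp Plane 2 (volume.restrict Ω) × Lp ℝ 2 (surf Ω)

/-- The triple `p` is `(w, ∇w, w|∂Ω)` for the test function `w`. -/
structure IsSmoothGraph (w : Plane → ℝ) (p : GraphSpace Ω) : Prop where
  contDiff : ContDiff ℝ ∞ w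
  hasCompactSupport : HasCompactSupport w
  fst_ae_eq : p.1 =ᵐ[volume.restrict Ω] w
  grad_ae_eq : p.2.1 =ᵐ[volume.restrict Ω] gradient w
  trace_ae_eq : p.2.2 =ᵐ[surf Ω] w

namespace IsSmoothGraph

variable {v w : Plane → ℝ} {p q : GraphSpace Ω}

theorem differentiableAt (h : IsSmoothGraph w p) (x : Plane) : DifferentiableAt ℝ w x :=
  h.contDiff.differentiable (by simp) x

theorem zero : IsSmoothGraph 0 (0 : GraphSpace Ω) where
  contDiff := contDiff_const
  hasCompactSupport := HasCompactSupport.zero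
  fst_ae_eq := Lp.coeFn_zero _ _ _
  grad_ae_eq := (Lp.coeFn_zero _ _ _).trans (Eventually.of_forall fun x => by simp [gradient])
  trace_ae_eq := Lp.coeFn_zero _ _ _

theorem add (hv : IsSmoothGraph v p) (hw : IsSmoothGraph w q) : IsSmoothGraph (v + w) (p + q) where
  contDiff := hv.contDiff.add hw.contDiff
  hasCompactSupport := hv.hasCompactSupport.add hw.hasCompactSupport
  fst_ae_eq := (Lp.coeFn_add _ _).trans (hv.fst_ae_eq.add hw.fst_ae_eq)
  grad_ae_eq := (Lp.coeFn_add _ _).trans <| (hv.grad_ae_eq.add hw.grad_ae_eq).trans <|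
    Eventually.of_forall fun x =>
      (gradient_add (hv.differentiableAt x) (hw.differentiableAt x)).symm
  trace_ae_eq := (Lp.coeFn_add _ _).trans (hv.trace_ae_eq.add hw.trace_ae_eq)

theorem const_smul (hv : IsSmoothGraph v p) (c : ℝ) : IsSmoothGraph (c • v) (c • p) where
  contDiff := contDiff_const.smul hv.contDiff
  hasCompactSupport := hv.hasCompactSupport.smul_left (f := fun _ => c)
  fst_ae_eq := (Lp.coeFn_smul _ _).trans (hv.fst_ae_eq.const_smul c)
  grad_ae_eq := (Lp.coeFn_smul _ _).trans <| (hv.grad_ae_eq.const_smul c).trans <|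
    Eventually.of_forall fun x => (gradient_const_smul (hv.differentiableAt x) c).symm
  trace_ae_eq := (Lp.coeFn_smul _ _).trans (hv.trace_ae_eq.const_smul c)

end IsSmoothGraph

theorem exists_isSmoothGraph [IsFiniteMeasure (volume.restrict Ω)] [IsFiniteMeasure (surf Ω)]
    {w : Plane → ℝ} (hw : ContDiff ℝ ∞ w) (hc : HasCompactSupport w) :
    ∃ p : GraphSpace Ω, IsSmoothGraph w p := by
  have hmem (μ : Measure Plane) [IsFiniteMeasure μ] : MemLp w 2 μ :=
    hw.continuous.memLp_of_hasCompactSupport hc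
  have hgrad : MemLp (gradient w) 2 (volume.restrict Ω) :=
    (continuous_gradient (hw.of_le (by simp))).memLp_of_hasCompactSupport
      (hasCompactSupport_gradient hc)
  exact ⟨((hmem _).toLp, hgrad.toLp, (hmem _).toLp),
    hw, hc, (hmem _).coeFn_toLp, hgrad.coeFn_toLp, (hmem _).coeFn_toLp⟩

/-- The triples of test functions; their closure consists of the `H¹(Ω)` functions together with
their trace. -/
def smoothGraph (Ω : Set Plane) : Submodule ℝ (GraphSpace Ω) where
  carrier := {p | ∃ w, IsSmoothGraph w p}
  zero_mem' := ⟨0, .zero⟩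
  add_mem' := fun ⟨_, hv⟩ ⟨_, hw⟩ => ⟨_, hv.add hw⟩
  smul_mem' := fun c _ ⟨_, hv⟩ => ⟨_, hv.const_smul c⟩

theorem isTrace_iff_mem_closure [IsFiniteMeasure (volume.restrict Ω)] [IsFiniteMeasure (surf Ω)]
    (u : H1 Ω) (t : Lp ℝ 2 (surf Ω)) :
    IsTrace u t ↔ (u.val, u.grad, t) ∈ (smoothGraph Ω).topologicalClosure := by
  have tendsto_iff {w : ℕ → Plane → ℝ} {p : ℕ → GraphSpace Ω} (h : ∀ n, IsSmoothGraph (w n) (p n)) :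
      Tendsto p atTop (𝓝 (u.val, u.grad, t)) ↔
        Tendsto (fun n => eLpNorm (fun x => w n x - u.val x) 2 (volume.restrict Ω)) atTop (𝓝 0) ∧
        Tendsto (fun n => eLpNorm (fun x => gradient (w n) x - u.grad x) 2 (volume.restrict Ω))
          atTop (𝓝 0) ∧
        Tendsto (fun n => eLpNorm (fun x => w n x - t x) 2 (surf Ω)) atTop (𝓝 0) := by
    rw [Prod.tendsto_iff, Prod.tendsto_iff,
      tendsto_Lp_iff_tendsto_eLpNorm_of_ae_eq fun n => (h n).fst_ae_eq,
      tendsto_Lp_iff_tendsto_eLpNorm_of_ae_eq fun n => (h n).grad_ae_eq,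
      tendsto_Lp_iff_tendsto_eLpNorm_of_ae_eq fun n => (h n).trace_ae_eq]
  rw [← SetLike.mem_coe, Submodule.topologicalClosure_coe, mem_closure_iff_seq_limit]
  constructor
  · rintro ⟨w, hw, hlim⟩
    choose p hp using fun n => exists_isSmoothGraph (Ω := Ω) (hw n).1 (hw n).2
    exact ⟨p, fun n => ⟨w n, hp n⟩, (tendsto_iff hp).2 hlim⟩
  · rintro ⟨p, hp, hlim⟩
    choose w hw using hp
    exact ⟨w, fun n => ⟨(hw n).contDiff, (hw n).hasCompactSupport⟩, (tendsto_iff hw).1 hlim⟩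

theorem exists_clm_eq_integral_add_integral (Ω : Set Plane) {η : Plane → ℝ} (hη : ContDiff ℝ 1 η)
    (hc : HasCompactSupport η) (e : Plane) :
    ∃ L : GraphSpace Ω →L[ℝ] ℝ, ∀ p, L p =
      (∫ x in Ω, p.1 x * fderiv ℝ η x e) + ∫ x in Ω, inner ℝ (p.2.1 x) e * η x := by
  have hderiv : MemLp (fun x => fderiv ℝ η x e) 2 (volume.restrict Ω) :=
    ((hη.continuous_fderiv one_ne_zero).clm_apply continuous_const).memLp_of_hasCompactSupport
      (hc.fderiv_apply ℝ e)
  have hsmul : MemLp (fun x => η x • e) 2 (volume.restrict Ω) :=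
    (hη.continuous.smul continuous_const).memLp_of_hasCompactSupport hc.smul_right
  refine ⟨(innerSL ℝ hderiv.toLp).comp (.fst ℝ _ _) +
    (innerSL ℝ hsmul.toLp).comp ((ContinuousLinearMap.fst ℝ _ _).comp (.snd ℝ _ _)), fun p => ?_⟩
  change inner ℝ hderiv.toLp p.1 + inner ℝ hsmul.toLp p.2.1 = _
  rw [L2.inner_def, L2.inner_def]
  congr 1
  · refine integral_congr_ae ?_
    filter_upwards [hderiv.coeFn_toLp] with x hx
    simp [hx]
  · refine integral_congr_ae ?_
    filter_upwards [hsmul.coeFn_toLp] with x hx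
    rw [hx, real_inner_smul_left, real_inner_comm, mul_comm]

/-- The triples whose second component is the weak gradient of the first. -/
def weakGradientGraph (Ω : Set Plane) : Submodule ℝ (GraphSpace Ω) where
  carrier := {p | IsWeakGradient Ω p.1 p.2.1}
  zero_mem' := by
    intro η hη hc _ e
    obtain ⟨L, hL⟩ := exists_clm_eq_integral_add_integral Ω (hη.of_le (by simp)) hc e
    rw [eq_neg_iff_add_eq_zero, ← hL, map_zero]
  add_mem' := by
    intro p q hp hq η hη hc hs e
    obtain ⟨L, hL⟩ := exists_clm_eq_integral_add_integral Ω (hη.of_le (by simp)) hc e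
    have hLp := hp η hη hc hs e
    have hLq := hq η hη hc hs e
    rw [eq_neg_iff_add_eq_zero, ← hL] at hLp hLq ⊢
    rw [map_add, hLp, hLq, add_zero]
  smul_mem' := by
    intro c p hp η hη hc hs e
    obtain ⟨L, hL⟩ := exists_clm_eq_integral_add_integral Ω (hη.of_le (by simp)) hc e
    have hLp := hp η hη hc hs e
    rw [eq_neg_iff_add_eq_zero, ← hL] at hLp ⊢
    rw [map_smul, hLp, smul_zero]

theorem isClosed_weakGradientGraph (Ω : Set Plane) :
    IsClosed (weakGradientGraph Ω : Set (GraphSpace Ω)) := by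
  have hset : (weakGradientGraph Ω : Set (GraphSpace Ω)) =
      ⋂ (η : Plane → ℝ) (_ : ContDiff ℝ ∞ η) (_ : HasCompactSupport η) (_ : tsupport η ⊆ Ω)
        (e : Plane), {p : GraphSpace Ω | ∫ x in Ω, p.1 x * fderiv ℝ η x e =
          -∫ x in Ω, inner ℝ (p.2.1 x) e * η x} := by
    ext p
    simp only [Set.mem_iInter]
    rfl
  rw [hset]
  refine isClosed_iInter fun η => isClosed_iInter fun hη => isClosed_iInter fun hc =>
    isClosed_iInter fun _ => isClosed_iInter fun e => ?_
  obtain ⟨L, hL⟩ := exists_clm_eq_integral_add_integral Ω (hη.of_le (by simp)) hc e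
  simp only [eq_neg_iff_add_eq_zero, ← hL]
  exact isClosed_eq L.continuous continuous_const

/-- The triples `(v, ∇v, v|∂Ω)` with `v ∈ V`. -/
def graphV (Ω ΓD : Set Plane) : Submodule ℝ (GraphSpace Ω) :=
  (smoothGraph Ω).topologicalClosure ⊓ weakGradientGraph Ω ⊓
    ((LpToLpRestrictCLM Plane ℝ ℝ (surf Ω) 2 ΓD).comp
      ((ContinuousLinearMap.snd ℝ _ _).comp (ContinuousLinearMap.snd ℝ _ _))).ker

theorem isClosed_graphV (Ω ΓD : Set Plane) : IsClosed (graphV Ω ΓD : Set (GraphSpace Ω)) :=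
  ((Submodule.isClosed_topologicalClosure _).inter (isClosed_weakGradientGraph Ω)).inter
    (ContinuousLinearMap.isClosed_ker _)

theorem mem_graphV {p : GraphSpace Ω} :
    p ∈ graphV Ω ΓD ↔ (p ∈ (smoothGraph Ω).topologicalClosure ∧ IsWeakGradient Ω p.1 p.2.1) ∧
      ∀ᵐ x ∂(surf Ω).restrict ΓD, p.2.2 x = 0 := by
  refine and_congr Iff.rfl ?_
  change LpToLpRestrictCLM Plane ℝ ℝ (surf Ω) 2 ΓD p.2.2 = 0 ↔ _
  rw [Lp.eq_zero_iff_ae_eq_zero]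
  refine eventually_congr ?_
  filter_upwards [LpToLpRestrictCLM_coeFn ℝ (p := 2) ΓD p.2.2] with x hx
  rw [hx, Pi.zero_apply]

/-- An element of `V` amounts to its triple. -/
def equivGraphV (Ω ΓD : Set Plane) [IsFiniteMeasure (volume.restrict Ω)]
    [IsFiniteMeasure (surf Ω)] : V Ω ΓD ≃ graphV Ω ΓD where
  toFun v := ⟨(v.val, v.grad, v.trace), mem_graphV.2
    ⟨⟨(isTrace_iff_mem_closure _ _).1 v.isTrace, v.isWeakGradient⟩, v.trace_eq_zero⟩⟩
  invFun p :=
    { val := p.1.1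
      grad := p.1.2.1
      isWeakGradient := (mem_graphV.1 p.2).1.2
      trace := p.1.2.2
      isTrace := (isTrace_iff_mem_closure _ _).2 (mem_graphV.1 p.2).1.1
      trace_eq_zero := (mem_graphV.1 p.2).2 }

end GraphSpace

section HilbertModel

variable {Ω ΓD : Set Plane}

/-- An identification of `V`, normed by the `L²` norm of the gradient, with an inner product
space `H` on which the trace is a bounded linear map. -/
structure HilbertModel (Ω ΓD : Set Plane) (H : Type*) [NormedAddCommGroup H]
    [InnerProductSpace ℝ H] where
  equiv : V Ω ΓD ≃ H
  inner_equiv : ∀ u v, inner ℝ (equiv u) (equiv v) = ∫ x in Ω, inner ℝ (u.grad x) (v.grad x)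
  normV_eq : ∀ v, normV v = ‖equiv v‖ₑ
  trace : H →L[ℝ] Lp ℝ 2 (surf Ω)
  trace_equiv : ∀ v, trace (equiv v) = v.trace

theorem IsLipschitzDomain.exists_norm_le_norm_grad (hΩ : IsLipschitzDomain Ω)
    (hD : 0 < surf Ω ΓD) :
    ∃ C : ℝ≥0, ∀ p ∈ graphV Ω ΓD, ‖p‖ ≤ C * ‖p.2.1‖ := by
  obtain ⟨C, hC⟩ := hΩ.friedrichs hD
  set R := LpToLpRestrictCLM Plane ℝ ℝ (surf Ω) 2 ΓD
  set S : Set (GraphSpace Ω) :=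
    {p | ‖p.1‖ₑ ^ 2 + ‖p.2.2‖ₑ ^ 2 ≤ C * (‖R p.2.2‖ₑ ^ 2 + ‖p.2.1‖ₑ ^ 2)}
  have hS : IsClosed S := isClosed_le (by fun_prop)
    ((ENNReal.continuous_const_mul ENNReal.coe_ne_top).comp (by fun_prop))
  have smooth_subset : (smoothGraph Ω : Set (GraphSpace Ω)) ⊆ S := by
    rintro p ⟨w, hw⟩
    have hR : R p.2.2 =ᵐ[(surf Ω).restrict ΓD] w :=
      (LpToLpRestrictCLM_coeFn ℝ ΓD p.2.2).trans (ae_restrict_of_ae hw.trace_ae_eq)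
    have := hC w (hw.contDiff.of_le (by simp))
    rw [lintegral_add_measure] at this
    simpa only [S, Set.mem_ofPred_eq, enorm_sq_eq_lintegral_of_ae_eq hw.fst_ae_eq,
      enorm_sq_eq_lintegral_of_ae_eq hw.grad_ae_eq, enorm_sq_eq_lintegral_of_ae_eq hw.trace_ae_eq,
      enorm_sq_eq_lintegral_of_ae_eq hR, enorm_gradient] using this
  refine ⟨1 + C, fun p hp => ?_⟩
  have hpS : p ∈ S := closure_minimal smooth_subset hS hp.1.1
  have hR : R p.2.2 = 0 := hp.2
  simp only [S, Set.mem_ofPred_eq, hR, enorm_eq_nnnorm, nnnorm_zero, ENNReal.coe_zero,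
    zero_pow two_ne_zero, zero_add] at hpS
  have hle : ‖p.1‖ ^ 2 + ‖p.2.2‖ ^ 2 ≤ C * ‖p.2.1‖ ^ 2 := by exact_mod_cast hpS
  have hbound : C * ‖p.2.1‖ ^ 2 ≤ ((1 + C : ℝ≥0) * ‖p.2.1‖) ^ 2 := by
    rw [mul_pow]
    gcongr
    push_cast
    nlinarith [C.2, sq_nonneg (C : ℝ)]
  refine max_le ?_ (max_le ?_ ?_)
  · exact le_of_sq_le_sq (by linarith [sq_nonneg ‖p.2.2‖]) (by positivity)
  · exact le_mul_of_one_le_left (norm_nonneg _) (by simp)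
  · exact le_of_sq_le_sq (by linarith [sq_nonneg ‖p.1‖]) (by positivity)

theorem exists_factorization_of_antilipschitz.{u, v} {E : Type u} {F : Type v}
    [NormedAddCommGroup E] [NormedSpace ℝ E] [CompleteSpace E] [NormedAddCommGroup F]
    [InnerProductSpace ℝ F] [CompleteSpace F] {G : E →L[ℝ] F} {C : ℝ≥0}
    (hG : AntilipschitzWith C G) :
    ∃ (H : Type v) (_ : NormedAddCommGroup H) (_ : InnerProductSpace ℝ H) (_ : CompleteSpace H)
      (f : E ≃L[ℝ] H) (ι : H →ₗᵢ[ℝ] F), ∀ x, ι (f x) = G x := by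
  have hclosed := hG.isClosed_range G.uniformContinuous
  exact ⟨_, inferInstance, inferInstance, hclosed.completeSpace_coe,
    ContinuousLinearMap.equivRange hG.injective hclosed, Submodule.subtypeₗᵢ _, fun _ => rfl⟩

theorem IsLipschitzDomain.exists_hilbertModel (hΩ : IsLipschitzDomain Ω) (hD : 0 < surf Ω ΓD) :
    ∃ (H : Type) (_ : NormedAddCommGroup H) (_ : InnerProductSpace ℝ H) (_ : CompleteSpace H),
      Nonempty (HilbertModel Ω ΓD H) := by
  have := hΩ.isFiniteMeasure_restrict
  have := hΩ.isFiniteMeasure_surf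
  have : CompleteSpace (graphV Ω ΓD) := (isClosed_graphV Ω ΓD).completeSpace_coe
  obtain ⟨C, hC⟩ := hΩ.exists_norm_le_norm_grad hD
  let grad : graphV Ω ΓD →L[ℝ] Lp Plane 2 (volume.restrict Ω) :=
    ((ContinuousLinearMap.fst ℝ _ _).comp (.snd ℝ _ _)).comp (graphV Ω ΓD).subtypeL
  let trace : graphV Ω ΓD →L[ℝ] Lp ℝ 2 (surf Ω) :=
    ((ContinuousLinearMap.snd ℝ _ _).comp (.snd ℝ _ _)).comp (graphV Ω ΓD).subtypeL
  have hgrad : AntilipschitzWith C grad := grad.antilipschitz_of_bound fun p => hC p p.2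
  obtain ⟨H, _, _, hH, f, ι, hι⟩ := exists_factorization_of_antilipschitz hgrad
  have grad_eq (v : V Ω ΓD) : ι (f (equivGraphV Ω ΓD v)) = v.grad := hι (equivGraphV Ω ΓD v)
  have inner_eq (u v : V Ω ΓD) : inner ℝ (f (equivGraphV Ω ΓD u)) (f (equivGraphV Ω ΓD v)) =
      ∫ x in Ω, inner ℝ (u.grad x) (v.grad x) := by
    rw [← ι.inner_map_map, grad_eq, grad_eq]
    exact L2.inner_def u.grad v.grad
  have norm_eq (v : V Ω ΓD) : normV v = ‖f (equivGraphV Ω ΓD v)‖ₑ := by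
    rw [← ι.enorm_map, grad_eq]
    exact (Lp.enorm_def v.grad).symm
  exact ⟨H, inferInstance, inferInstance, hH, ⟨
    { equiv := (equivGraphV Ω ΓD).trans f.toEquiv
      inner_equiv := inner_eq
      normV_eq := norm_eq
      trace := trace.comp (f.symm : H →L[ℝ] graphV Ω ΓD)
      trace_equiv := fun v => congrArg trace (f.symm_apply_apply (equivGraphV Ω ΓD v)) }⟩⟩

end HilbertModel

section Contraction

theorem existsUnique_mem_eq_of_contraction {X : Type*} [MetricSpace X] {s : Set X} {F : X → X}
    {q : ℝ≥0} (hs : IsComplete s) (hne : s.Nonempty) (hmaps : Set.MapsTo F s s)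
    (hF : LipschitzOnWith q F s) (hq : q < 1) : ∃! u, u ∈ s ∧ F u = u := by
  obtain ⟨x, hx⟩ := hne
  have hcontr : ContractingWith q (hmaps.restrict F s s) := ⟨hq, hF.mapsToRestrict hmaps⟩
  obtain ⟨u, hu, hfix, -⟩ := hcontr.exists_fixedPoint' hs hmaps hx (edist_ne_top _ _)
  refine ⟨u, ⟨hu, hfix⟩, fun w hw => ?_⟩
  have huniq := hcontr.fixedPoint_unique' (x := ⟨w, hw.1⟩) (y := ⟨u, hu⟩)
    (Subtype.ext hw.2) (Subtype.ext hfix)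
  exact congrArg Subtype.val huniq

variable {H Y : Type*} [NormedAddCommGroup H] [InnerProductSpace ℝ H] [NormedAddCommGroup Y]
  [NormedSpace ℝ Y]

theorem norm_add_quadratic_le {M : ℝ} (B : H →L[ℝ] StrongDual ℝ H) (P : H →L[ℝ] H →L[ℝ] Y)
    (Z : Y →L[ℝ] StrongDual ℝ H) {u : H} (hu : ‖u‖ ≤ M) :
    ‖B u + Z (P u u)‖ ≤ ‖B‖ * M + ‖Z‖ * ‖P‖ * M ^ 2 :=
  calc ‖B u + Z (P u u)‖ ≤ ‖B u‖ + ‖Z (P u u)‖ := norm_add_le _ _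
    _ ≤ ‖B‖ * ‖u‖ + ‖Z‖ * (‖P‖ * ‖u‖ * ‖u‖) :=
        add_le_add (B.le_opNorm u) (Z.le_opNorm_of_le (P.le_opNorm₂ u u))
    _ = ‖B‖ * ‖u‖ + ‖Z‖ * ‖P‖ * ‖u‖ ^ 2 := by ring
    _ ≤ ‖B‖ * M + ‖Z‖ * ‖P‖ * M ^ 2 := by gcongr

theorem norm_add_quadratic_sub_le {M : ℝ} (B : H →L[ℝ] StrongDual ℝ H)
    (P : H →L[ℝ] H →L[ℝ] Y) (Z : Y →L[ℝ] StrongDual ℝ H) {u w : H} (hu : ‖u‖ ≤ M)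
    (hw : ‖w‖ ≤ M) :
    ‖B u + Z (P u u) - (B w + Z (P w w))‖ ≤ (‖B‖ + 2 * M * (‖Z‖ * ‖P‖)) * ‖u - w‖ :=
  calc ‖B u + Z (P u u) - (B w + Z (P w w))‖
      = ‖B (u - w) + Z (P u (u - w)) + Z (P (u - w) w)‖ := by
        simp only [map_sub, sub_apply]
        congr 1
        abel
    _ ≤ ‖B (u - w)‖ + ‖Z (P u (u - w))‖ + ‖Z (P (u - w) w)‖ := norm_add₃_le
    _ ≤ ‖B‖ * ‖u - w‖ + ‖Z‖ * (‖P‖ * ‖u‖ * ‖u - w‖) + ‖Z‖ * (‖P‖ * ‖u - w‖ * ‖w‖) :=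
        add_le_add_three (B.le_opNorm _) (Z.le_opNorm_of_le (P.le_opNorm₂ _ _))
          (Z.le_opNorm_of_le (P.le_opNorm₂ _ _))
    _ ≤ ‖B‖ * ‖u - w‖ + ‖Z‖ * (‖P‖ * M * ‖u - w‖) + ‖Z‖ * (‖P‖ * ‖u - w‖ * M) := by gcongr
    _ = (‖B‖ + 2 * M * (‖Z‖ * ‖P‖)) * ‖u - w‖ := by ring

theorem existsUnique_inner_add_quadratic_eq [CompleteSpace H] {M : ℝ} (hM : 0 ≤ M)
    (B : H →L[ℝ] StrongDual ℝ H) (P : H →L[ℝ] H →L[ℝ] Y) (Z : Y →L[ℝ] StrongDual ℝ H)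
    (ℓ : StrongDual ℝ H) (hcontr : ‖B‖ + 2 * M * (‖Z‖ * ‖P‖) < 1)
    (hball : ‖ℓ‖ + (‖B‖ * M + ‖Z‖ * ‖P‖ * M ^ 2) ≤ M) :
    ∃! u : H, ‖u‖ ≤ M ∧ ∀ v, inner ℝ u v + (B u v + Z (P u u) v) = ℓ v := by
  set J := InnerProductSpace.toDual ℝ H
  set F : H → H := fun u => J.symm (ℓ - (B u + Z (P u u)))
  have solution_iff : ∀ u, (∀ v, inner ℝ u v + (B u v + Z (P u u) v) = ℓ v) ↔ F u = u := by
    intro u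
    rw [LinearIsometryEquiv.symm_apply_eq, ContinuousLinearMap.ext_iff]
    refine forall_congr' fun v => ?_
    rw [sub_apply, InnerProductSpace.toDual_apply_apply, sub_eq_iff_eq_add, eq_comm]
    rfl
  have hmaps : Set.MapsTo F (Metric.closedBall 0 M) (Metric.closedBall 0 M) := fun u hu => by
    rw [mem_closedBall_zero_iff] at hu ⊢
    rw [J.symm.norm_map]
    exact (norm_sub_le _ _).trans
      ((add_le_add_right (norm_add_quadratic_le B P Z hu) _).trans hball)
  have hlip : LipschitzOnWith (‖B‖ + 2 * M * (‖Z‖ * ‖P‖)).toNNReal F (Metric.closedBall 0 M) := by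
    refine LipschitzOnWith.of_dist_le_mul fun u hu w hw => ?_
    rw [Real.coe_toNNReal _ (by positivity), J.symm.dist_map, dist_eq_norm, dist_eq_norm,
      sub_sub_sub_cancel_left, norm_sub_rev]
    exact norm_add_quadratic_sub_le B P Z (mem_closedBall_zero_iff.1 hu)
      (mem_closedBall_zero_iff.1 hw)
  simpa only [solution_iff, mem_closedBall_zero_iff] using
    existsUnique_mem_eq_of_contraction Metric.isClosed_closedBall.isComplete
      (Metric.nonempty_closedBall.2 hM) hmaps hlip (Real.toNNReal_lt_one.2 hcontr)

end Contraction

section WeightedPairing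

open ContinuousLinearMap (mul)

variable {X : Type*} [MeasurableSpace X] {μ : Measure X} {p q : ℝ≥0∞}

theorem ae_norm_le_norm (φ : Lp ℝ ∞ μ) : ∀ᵐ x ∂μ, ‖φ x‖ ≤ ‖φ‖ := by
  filter_upwards [enorm_ae_le_eLpNormEssSup φ μ] with x hx
  rw [← eLpNorm_exponent_top, ← Lp.enorm_def] at hx
  exact enorm_le_iff_norm_le.1 hx

theorem integrable_weight_mul [p.HolderConjugate q] (φ : Lp ℝ ∞ μ) (f : Lp ℝ p μ)
    (k : Lp ℝ q μ) : Integrable (fun x => φ x * (f x * k x)) μ :=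
  ((Lp.memLp f).integrable_mul (Lp.memLp k)).bdd_mul (Lp.aestronglyMeasurable φ)
    (ae_norm_le_norm φ)

theorem norm_mul_holder_le {r : ℝ≥0∞} [p.HolderTriple q r] (f : Lp ℝ p μ) (k : Lp ℝ q μ) :
    ‖(mul ℝ ℝ).holder r f k‖ ≤ ‖f‖ * ‖k‖ := by
  simpa using (mul ℝ ℝ).norm_holder_apply_apply_le (r := r) f k

/-- The bilinear form `(f, k) ↦ ∫ φ f k` on `L^p × L^q`, for a weight `φ ∈ L^∞` and conjugate
exponents `p`, `q`. -/
def weightedPairing (p q : ℝ≥0∞) [Fact (1 ≤ p)] [Fact (1 ≤ q)] [p.HolderConjugate q]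
    (φ : Lp ℝ ∞ μ) : Lp ℝ p μ →L[ℝ] Lp ℝ q μ →L[ℝ] ℝ :=
  ((mul ℝ ℝ).lpPairing μ p q).comp ((mul ℝ ℝ).holderL μ ∞ p p φ)

variable [Fact (1 ≤ p)] [Fact (1 ≤ q)] [p.HolderConjugate q]

theorem weightedPairing_apply (φ : Lp ℝ ∞ μ) (f : Lp ℝ p μ) (k : Lp ℝ q μ) :
    weightedPairing p q φ f k = ∫ x, φ x * (f x * k x) ∂μ := by
  refine ((mul ℝ ℝ).lpPairing_eq_integral _ k).trans (integral_congr_ae ?_)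
  filter_upwards [(mul ℝ ℝ).coeFn_holder (r := p) φ f] with x hx
  exact (congrArg (· * k x) hx).trans (mul_assoc _ _ _)

theorem norm_weightedPairing_le (φ : Lp ℝ ∞ μ) : ‖weightedPairing p q φ‖ ≤ ‖φ‖ := by
  refine ContinuousLinearMap.opNorm_le_bound₂ _ (norm_nonneg φ) fun f k => ?_
  have pairing_eq : weightedPairing p q φ f k =
      L1.integral ((mul ℝ ℝ).holder 1 ((mul ℝ ℝ).holder p φ f) k) := by
    rw [L1.integral_eq' ℝ]
    rfl
  calc ‖weightedPairing p q φ f k‖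
      ≤ ‖(mul ℝ ℝ).holder 1 ((mul ℝ ℝ).holder p φ f) k‖ := pairing_eq ▸ L1.norm_integral_le _
    _ ≤ ‖(mul ℝ ℝ).holder p φ f‖ * ‖k‖ := norm_mul_holder_le _ _
    _ ≤ ‖φ‖ * ‖f‖ * ‖k‖ := by gcongr; exact norm_mul_holder_le _ _

end WeightedPairing

section Robin

open ContinuousLinearMap (mul)

variable {H X : Type*} [NormedAddCommGroup H] [InnerProductSpace ℝ H] [MeasurableSpace X]
  {μ : Measure X}

instance holderTriple_three : ENNReal.HolderTriple 3 3 (3 / 2) :=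
  ⟨by rw [ENNReal.inv_div (by simp) (by simp), ← two_mul, div_eq_mul_inv]⟩

instance holderConjugate_three : ENNReal.HolderConjugate (3 / 2) 3 :=
  ⟨by
    rw [ENNReal.inv_div (by simp) (by simp), inv_one, ← one_div, ENNReal.div_add_div_same,
      two_add_one_eq_three]
    exact ENNReal.div_self (by simp) (by simp)⟩

instance fact_one_le_three : Fact ((1 : ℝ≥0∞) ≤ 3) := ⟨by norm_num⟩

instance fact_one_le_three_div_two : Fact ((1 : ℝ≥0∞) ≤ 3 / 2) :=
  ⟨(ENNReal.le_div_iff_mul_le (by simp) (by simp)).2 (by norm_num)⟩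

theorem norm_bilinearComp_le {E F G E' F' : Type*} [NormedAddCommGroup E] [NormedSpace ℝ E]
    [NormedAddCommGroup F] [NormedSpace ℝ F] [NormedAddCommGroup G] [NormedSpace ℝ G]
    [NormedAddCommGroup E'] [NormedSpace ℝ E'] [NormedAddCommGroup F'] [NormedSpace ℝ F']
    (f : E →L[ℝ] F →L[ℝ] G) (S : E' →L[ℝ] E) (T : F' →L[ℝ] F) :
    ‖f.bilinearComp S T‖ ≤ ‖f‖ * ‖S‖ * ‖T‖ := by
  refine ContinuousLinearMap.opNorm_le_bound₂ _ (by positivity) fun x y => ?_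
  calc ‖f (S x) (T y)‖ ≤ ‖f‖ * (‖S‖ * ‖x‖) * (‖T‖ * ‖y‖) :=
        f.le_of_opNorm₂_le_of_le le_rfl (S.le_opNorm x) (T.le_opNorm y)
    _ = ‖f‖ * ‖S‖ * ‖T‖ * ‖x‖ * ‖y‖ := by ring

theorem integral_robin_eq {f₂ k₂ : Lp ℝ 2 μ} {f₃ k₃ : Lp ℝ 3 μ} (hf : f₂ =ᵐ[μ] f₃)
    (hk : k₂ =ᵐ[μ] k₃) (φ : Lp ℝ ∞ μ) (κ : ℝ) :
    ∫ x, φ x * (f₂ x + κ * f₂ x ^ 2) * k₂ x ∂μ = weightedPairing 2 2 φ f₂ k₂ +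
      weightedPairing (3 / 2) 3 φ (κ • (mul ℝ ℝ).holder (3 / 2) f₃ f₃) k₃ := by
  rw [weightedPairing_apply, weightedPairing_apply, ← integral_add (integrable_weight_mul _ _ _)
    (integrable_weight_mul _ _ _)]
  refine integral_congr_ae ?_
  filter_upwards [hf, hk, Lp.coeFn_smul κ ((mul ℝ ℝ).holder (3 / 2) f₃ f₃),
    (mul ℝ ℝ).coeFn_holder (r := 3 / 2) f₃ f₃] with x hfx hkx hsmul hmul
  rw [hsmul, Pi.smul_apply, hmul, hfx, hkx, ContinuousLinearMap.mul_apply', smul_eq_mul]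
  ring

theorem existsUnique_robin [CompleteSpace H] {M κ : ℝ} (hM : 0 ≤ M) (hκ : |κ| ≤ 1 / 2)
    {φ : Lp ℝ ∞ μ} {S₂ : H →L[ℝ] Lp ℝ 2 μ} {S₃ : H →L[ℝ] Lp ℝ 3 μ}
    (hS : ∀ u, S₂ u =ᵐ[μ] S₃ u) {ℓ : StrongDual ℝ H} (hℓ : ‖ℓ‖ ≤ M / 2)
    (hS₂ : ‖φ‖ * ‖S₂‖ ^ 2 ≤ 1 / 4) (hS₃ : ‖φ‖ * ‖S₃‖ ^ 3 * M ≤ 1 / 2) :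
    ∃! u : H, ‖u‖ ≤ M ∧
      ∀ v, inner ℝ u v + ∫ x, φ x * (S₂ u x + κ * S₂ u x ^ 2) * S₂ v x ∂μ = ℓ v := by
  let B := (weightedPairing 2 2 φ).bilinearComp S₂ S₂
  let P := κ • ((mul ℝ ℝ).holderL μ 3 3 (3 / 2)).bilinearComp S₃ S₃
  let Z := (weightedPairing (3 / 2) 3 φ).bilinearComp (.id ℝ _) S₃
  have hB : ‖B‖ ≤ 1 / 4 := calc
    ‖B‖ ≤ ‖weightedPairing 2 2 φ‖ * ‖S₂‖ * ‖S₂‖ := norm_bilinearComp_le _ _ _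
    _ ≤ ‖φ‖ * ‖S₂‖ * ‖S₂‖ := by gcongr; exact norm_weightedPairing_le φ
    _ ≤ 1 / 4 := by rwa [mul_assoc, ← sq]
  have hP : ‖P‖ ≤ 1 / 2 * ‖S₃‖ ^ 2 := by
    refine ContinuousLinearMap.opNorm_le_bound₂ _ (by positivity) fun u w => ?_
    calc ‖κ • (mul ℝ ℝ).holder (3 / 2) (S₃ u) (S₃ w)‖
        = |κ| * ‖(mul ℝ ℝ).holder (3 / 2) (S₃ u) (S₃ w)‖ := norm_smul _ _
      _ ≤ 1 / 2 * (‖S₃ u‖ * ‖S₃ w‖) := by gcongr; exact norm_mul_holder_le _ _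
      _ ≤ 1 / 2 * (‖S₃‖ * ‖u‖ * (‖S₃‖ * ‖w‖)) := by gcongr <;> exact S₃.le_opNorm _
      _ = 1 / 2 * ‖S₃‖ ^ 2 * ‖u‖ * ‖w‖ := by ring
  have hZ : ‖Z‖ ≤ ‖φ‖ * ‖S₃‖ := calc
    ‖Z‖ ≤ ‖weightedPairing (3 / 2) 3 φ‖ * ‖ContinuousLinearMap.id ℝ (Lp ℝ (3 / 2) μ)‖ * ‖S₃‖ :=
        norm_bilinearComp_le _ _ _
    _ ≤ ‖φ‖ * 1 * ‖S₃‖ := by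
        gcongr
        exacts [norm_weightedPairing_le φ, ContinuousLinearMap.norm_id_le]
    _ = ‖φ‖ * ‖S₃‖ := by rw [mul_one]
  have hZP : ‖Z‖ * ‖P‖ * M ≤ 1 / 4 := calc
    ‖Z‖ * ‖P‖ * M ≤ ‖φ‖ * ‖S₃‖ * (1 / 2 * ‖S₃‖ ^ 2) * M := by gcongr
    _ = 1 / 2 * (‖φ‖ * ‖S₃‖ ^ 3 * M) := by ring
    _ ≤ 1 / 4 := by linarith
  simp only [integral_robin_eq (hS _) (hS _)]
  refine existsUnique_inner_add_quadratic_eq hM B P Z ℓ (by linarith) ?_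
  nlinarith

theorem exists_clm_ae_eq_of_eLpNorm_le {H X E : Type*} [NormedAddCommGroup H] [NormedSpace ℝ H]
    [MeasurableSpace X] {μ : Measure X} [NormedAddCommGroup E] [NormedSpace ℝ E] {p q : ℝ≥0∞}
    [Fact (1 ≤ p)] [Fact (1 ≤ q)] (T : H →L[ℝ] Lp E q μ) {s : Set X} {C : ℝ≥0}
    (hT : ∀ u, eLpNorm (T u) p (μ.restrict s) ≤ C * ‖u‖ₑ) :
    ∃ S : H →L[ℝ] Lp E p (μ.restrict s), (∀ u, S u =ᵐ[μ.restrict s] T u) ∧ ‖S‖ ≤ C := by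
  have hmem (u : H) : MemLp (T u) p (μ.restrict s) :=
    ⟨(Lp.aestronglyMeasurable _).restrict,
      (hT u).trans_lt (ENNReal.mul_lt_top ENNReal.coe_lt_top enorm_lt_top)⟩
  let S : H →ₗ[ℝ] Lp E p (μ.restrict s) :=
    { toFun := fun u => (hmem u).toLp
      map_add' := fun u w => by
        rw [← MemLp.toLp_add, MemLp.toLp_eq_toLp_iff, map_add]
        exact ae_restrict_of_ae (Lp.coeFn_add _ _)
      map_smul' := fun c u => by
        rw [RingHom.id_apply, ← MemLp.toLp_const_smul, MemLp.toLp_eq_toLp_iff, map_smul]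
        exact ae_restrict_of_ae (Lp.coeFn_smul _ _) }
  have hS (u : H) : ‖S u‖ ≤ C * ‖u‖ := by
    have := ENNReal.toReal_mono (ENNReal.mul_ne_top ENNReal.coe_ne_top enorm_ne_top) (hT u)
    rwa [ENNReal.toReal_mul, toReal_enorm, ENNReal.coe_toReal, ← Lp.norm_toLp _ (hmem u)] at this
  exact ⟨S.mkContinuous C hS, fun u => (hmem u).coeFn_toLp, S.mkContinuous_norm_le C.2 hS⟩

theorem exists_dual_eq_integral_mul {T : H →L[ℝ] Lp ℝ 2 μ} {s : Set X} {C : ℝ≥0}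
    (hT : ∀ u, eLpNorm (T u) 2 (μ.restrict s) ≤ C * ‖u‖ₑ) {k : X → ℝ}
    (hk : MemLp k 2 (μ.restrict s)) :
    ∃ ℓ : StrongDual ℝ H, ‖ℓ‖ ≤ C * (eLpNorm k 2 (μ.restrict s)).toReal ∧
      ∀ v, ℓ v = ∫ x in s, k x * T v x ∂μ := by
  obtain ⟨S, hS, hS_norm⟩ := exists_clm_ae_eq_of_eLpNorm_le T hT
  refine ⟨(innerSL ℝ (hk.toLp k)).comp S, ?_, fun v => ?_⟩
  · calc ‖(innerSL ℝ (hk.toLp k)).comp S‖ ≤ ‖innerSL ℝ (hk.toLp k)‖ * ‖S‖ :=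
        ContinuousLinearMap.opNorm_comp_le _ _
      _ = ‖S‖ * (eLpNorm k 2 (μ.restrict s)).toReal := by
        rw [innerSL_apply_norm, Lp.norm_toLp, mul_comm]
      _ ≤ C * (eLpNorm k 2 (μ.restrict s)).toReal := by gcongr
  · refine (L2.inner_def (𝕜 := ℝ) (hk.toLp k) (S v)).trans (integral_congr_ae ?_)
    filter_upwards [hk.coeFn_toLp, hS v] with x hkx hSx
    rw [hkx, hSx, RCLike.inner_apply', conj_trivial]

theorem existsUnique_robin_of_eLpNorm_le [CompleteSpace H] {M κ ε : ℝ} (hM : 0 ≤ M)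
    (hκ : |κ| ≤ 1 / 2) (hε : 0 ≤ ε) {φ : X → ℝ} {Γ : Set X}
    (hφ : AEStronglyMeasurable φ (μ.restrict Γ))
    (hφε : eLpNorm φ ∞ (μ.restrict Γ) ≤ ENNReal.ofReal ε) {T : H →L[ℝ] Lp ℝ 2 μ} {β₂ β₃ : ℝ≥0}
    (hβ₂ : ∀ u, eLpNorm (T u) 2 (μ.restrict Γ) ≤ β₂ * ‖u‖ₑ)
    (hβ₃ : ∀ u, eLpNorm (T u) 3 (μ.restrict Γ) ≤ β₃ * ‖u‖ₑ)
    {ℓ : StrongDual ℝ H} (hℓ : ‖ℓ‖ ≤ M / 2) (hεβ₂ : ε * β₂ ^ 2 ≤ 1 / 4)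
    (hεβ₃ : ε * β₃ ^ 3 * M ≤ 1 / 2) :
    ∃! u : H, ‖u‖ ≤ M ∧
      ∀ v, inner ℝ u v + ∫ x in Γ, φ x * (T u x + κ * T u x ^ 2) * T v x ∂μ = ℓ v := by
  obtain ⟨S₂, hS₂, hS₂_norm⟩ := exists_clm_ae_eq_of_eLpNorm_le T hβ₂
  obtain ⟨S₃, hS₃, hS₃_norm⟩ := exists_clm_ae_eq_of_eLpNorm_le T hβ₃
  have hφ_mem : MemLp φ ∞ (μ.restrict Γ) := ⟨hφ, hφε.trans_lt ENNReal.ofReal_lt_top⟩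
  have hφ_norm : ‖hφ_mem.toLp‖ ≤ ε := by
    rw [Lp.norm_toLp]
    exact ENNReal.toReal_le_of_le_ofReal hε hφε
  have integral_eq (u v : H) : ∫ x in Γ, φ x * (T u x + κ * T u x ^ 2) * T v x ∂μ =
      ∫ x in Γ, hφ_mem.toLp φ x * (S₂ u x + κ * S₂ u x ^ 2) * S₂ v x ∂μ := by
    refine integral_congr_ae ?_
    filter_upwards [hφ_mem.coeFn_toLp, hS₂ u, hS₂ v] with x hφx hux hvx
    rw [hφx, hux, hvx]
  simp only [integral_eq]
  refine existsUnique_robin hM hκ (fun u => (hS₂ u).trans (hS₃ u).symm) hℓ ?_ ?_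
  · exact hεβ₂.trans' (by gcongr)
  · exact hεβ₃.trans' (by gcongr)

end Robin

section PartialTrace

variable {Ω ΓD ΓN ΓR Γ : Set Plane} {p : ℝ≥0∞}

theorem eLpNorm_trace_le (h : traceConst Ω ΓD Γ p ≠ ⊤) (u : V Ω ΓD) :
    eLpNorm u.trace p ((surf Ω).restrict Γ) ≤ traceConst Ω ΓD Γ p * normV u := by
  by_cases h0 : normV u = 0
  · have hlt : traceConst Ω ΓD Γ p < ⊤ := h.lt_top
    simp only [traceConst, iInf_lt_iff] at hlt
    obtain ⟨C, hC, -⟩ := hlt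
    simpa [h0] using hC.2 u
  · have hfin : normV u ≠ ⊤ := Lp.eLpNorm_ne_top _
    rw [← ENNReal.div_le_iff h0 hfin]
    refine le_iInf₂ fun C hC => ?_
    rw [ENNReal.div_le_iff h0 hfin]
    exact hC.2 u

theorem M₀_ne_top {Φ g : Plane → ℝ} (hR : traceConst Ω ΓD ΓR 2 ≠ ⊤)
    (hN : traceConst Ω ΓD ΓN 2 ≠ ⊤) (hΦ : MemLp Φ 2 ((surf Ω).restrict ΓN))
    (hg : MemLp g 2 ((surf Ω).restrict ΓR)) : M₀ Ω ΓD ΓN ΓR Φ g ≠ ⊤ :=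
  ENNReal.mul_ne_top (ENNReal.mul_ne_top (by simp) (max_lt hR.lt_top hN.lt_top).ne)
    (ENNReal.add_ne_top.2 ⟨hΦ.eLpNorm_ne_top, hg.eLpNorm_ne_top⟩)

theorem traceConst_mul_data_le {Φ g : Plane → ℝ} (hR : traceConst Ω ΓD ΓR 2 ≠ ⊤)
    (hN : traceConst Ω ΓD ΓN 2 ≠ ⊤) (hΦ : MemLp Φ 2 ((surf Ω).restrict ΓN))
    (hg : MemLp g 2 ((surf Ω).restrict ΓR)) :
    (traceConst Ω ΓD ΓN 2).toReal * (eLpNorm Φ 2 ((surf Ω).restrict ΓN)).toReal +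
      (traceConst Ω ΓD ΓR 2).toReal * (eLpNorm g 2 ((surf Ω).restrict ΓR)).toReal ≤
        (M₀ Ω ΓD ΓN ΓR Φ g).toReal / 2 := by
  rw [M₀, ENNReal.toReal_mul, ENNReal.toReal_mul, ENNReal.toReal_max hR hN,
    ENNReal.toReal_add hΦ.eLpNorm_ne_top hg.eLpNorm_ne_top, ENNReal.toReal_ofNat, mul_assoc,
    mul_div_cancel_left₀ _ two_ne_zero, mul_add]
  gcongr
  exacts [le_max_right _ _, le_max_left _ _]

namespace HilbertModel

variable {H : Type*} [NormedAddCommGroup H] [InnerProductSpace ℝ H] (m : HilbertModel Ω ΓD H)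

theorem traceConst_ne_top (m : HilbertModel Ω ΓD H) : traceConst Ω ΓD Γ 2 ≠ ⊤ := by
  have hle : traceConst Ω ΓD Γ 2 ≤ (‖m.trace‖₊ + 1 : ℝ≥0) := by
    refine iInf₂_le (‖m.trace‖₊ + 1) ⟨by positivity, fun v => ?_⟩
    calc eLpNorm v.trace 2 ((surf Ω).restrict Γ)
        ≤ eLpNorm v.trace 2 (surf Ω) := eLpNorm_mono_measure _ Measure.restrict_le_self
      _ = ‖m.trace (m.equiv v)‖ₑ := by rw [m.trace_equiv, Lp.enorm_def]
      _ ≤ ‖m.trace‖ₑ * ‖m.equiv v‖ₑ := m.trace.le_opENorm _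
      _ ≤ (‖m.trace‖₊ + 1 : ℝ≥0) * normV v := by
        rw [m.normV_eq, enorm_eq_nnnorm]
        gcongr
        exact le_self_add
  exact (hle.trans_lt ENNReal.coe_lt_top).ne

theorem eLpNorm_trace_le (h : traceConst Ω ΓD Γ p ≠ ⊤) (u : H) :
    eLpNorm (m.trace u) p ((surf Ω).restrict Γ) ≤ (traceConst Ω ΓD Γ p).toNNReal * ‖u‖ₑ := by
  obtain ⟨v, rfl⟩ := m.equiv.surjective u
  rw [m.trace_equiv, ← m.normV_eq, ENNReal.coe_toNNReal h]
  exact RobinProblem.eLpNorm_trace_le h v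

theorem exists_load {Φ g : Plane → ℝ} (hΦ : MemLp Φ 2 ((surf Ω).restrict ΓN))
    (hg : MemLp g 2 ((surf Ω).restrict ΓR)) :
    ∃ ℓ : StrongDual ℝ H, ‖ℓ‖ ≤ (M₀ Ω ΓD ΓN ΓR Φ g).toReal / 2 ∧
      ∀ v, ℓ v = (∫ x in ΓN, Φ x * m.trace v x ∂surf Ω) + ∫ x in ΓR, g x * m.trace v x ∂surf Ω := by
  obtain ⟨ℓN, hN, hN_apply⟩ := exists_dual_eq_integral_mul
    (m.eLpNorm_trace_le (m.traceConst_ne_top (Γ := ΓN))) hΦ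
  obtain ⟨ℓR, hR, hR_apply⟩ := exists_dual_eq_integral_mul
    (m.eLpNorm_trace_le (m.traceConst_ne_top (Γ := ΓR))) hg
  refine ⟨ℓN + ℓR, ?_, fun v => by rw [add_apply, hN_apply, hR_apply]⟩
  exact (norm_add_le ℓN ℓR).trans <| (add_le_add hN hR).trans
    (traceConst_mul_data_le m.traceConst_ne_top m.traceConst_ne_top hΦ hg)

theorem isWeakSolution_iff {α : ℝ} {φ Φ g : Plane → ℝ} {u : V Ω ΓD} :
    IsWeakSolution ΓN ΓR α φ Φ g u ↔ ∀ v : H, inner ℝ (m.equiv u) v +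
      ∫ x in ΓR, φ x * (m.trace (m.equiv u) x + (2 * α - 1) / 2 * m.trace (m.equiv u) x ^ 2) *
        m.trace v x ∂surf Ω =
      (∫ x in ΓN, Φ x * m.trace v x ∂surf Ω) + ∫ x in ΓR, g x * m.trace v x ∂surf Ω := by
  refine Iff.trans (forall_congr' fun v => ?_) m.equiv.surjective.forall.symm
  rw [m.trace_equiv, m.trace_equiv, m.inner_equiv]

theorem normV_le_iff {M : ℝ≥0∞} (hM : M ≠ ⊤) {v : V Ω ΓD} :
    normV v ≤ M ↔ ‖m.equiv v‖ ≤ M.toReal := by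
  rw [m.normV_eq, ← ENNReal.toReal_le_toReal enorm_ne_top hM, toReal_enorm]

end HilbertModel

end PartialTrace

section WeakSolution

variable {Ω ΓD ΓN ΓR : Set Plane} {α ε : ℝ} {φ Φ g : Plane → ℝ}

theorem mul_toReal_le_one_of_ofReal_le_one_div {x : ℝ≥0∞} (hε : 0 ≤ ε)
    (h : ENNReal.ofReal ε ≤ 1 / x) : ε * x.toReal ≤ 1 := by
  have := ENNReal.toReal_mono ENNReal.one_ne_top (ENNReal.mul_le_of_le_div h)
  rwa [ENNReal.toReal_mul, ENNReal.toReal_ofReal hε, ENNReal.toReal_one] at this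

theorem traceConst_three_ne_top (hε : 0 < ε) (hM : M₀ Ω ΓD ΓN ΓR Φ g ≠ 0)
    (h : ENNReal.ofReal ε ≤ 1 / (2 * traceConst Ω ΓD ΓR 3 ^ 3 * M₀ Ω ΓD ΓN ΓR Φ g)) :
    traceConst Ω ΓD ΓR 3 ≠ ⊤ := by
  intro htop
  rw [htop, ENNReal.top_pow three_ne_zero, ENNReal.mul_top two_ne_zero, ENNReal.top_mul hM,
    ENNReal.div_top, nonpos_iff_eq_zero, ENNReal.ofReal_eq_zero] at h
  exact hε.not_ge h

namespace HilbertModel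

variable {H : Type*} [NormedAddCommGroup H] [InnerProductSpace ℝ H] (m : HilbertModel Ω ΓD H)

theorem existsUnique_of_M₀_ne_zero [CompleteSpace H] (hα : α ∈ Set.Icc (0 : ℝ) 1) (hε : 0 < ε)
    (hε' : ENNReal.ofReal ε ≤ min (1 / (4 * traceConst Ω ΓD ΓR 2 ^ 2))
      (1 / (2 * traceConst Ω ΓD ΓR 3 ^ 3 * M₀ Ω ΓD ΓN ΓR Φ g)))
    (hφ : AEStronglyMeasurable φ ((surf Ω).restrict ΓR))
    (hφε : eLpNorm φ ∞ ((surf Ω).restrict ΓR) ≤ ENNReal.ofReal ε)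
    (hM : M₀ Ω ΓD ΓN ΓR Φ g ≠ 0) {ℓ : StrongDual ℝ H}
    (hℓ : ‖ℓ‖ ≤ (M₀ Ω ΓD ΓN ΓR Φ g).toReal / 2) :
    ∃! u : H, ‖u‖ ≤ (M₀ Ω ΓD ΓN ΓR Φ g).toReal ∧ ∀ v, inner ℝ u v +
      ∫ x in ΓR, φ x * (m.trace u x + (2 * α - 1) / 2 * m.trace u x ^ 2) * m.trace v x ∂surf Ω =
        ℓ v := by
  obtain ⟨hε₁, hε₂⟩ := le_min_iff.1 hε'
  have hβ₂ := traceConst_three_ne_top hε hM hε₂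
  have hκ : |(2 * α - 1) / 2| ≤ 1 / 2 := abs_le.2 ⟨by linarith [hα.1], by linarith [hα.2]⟩
  refine existsUnique_robin_of_eLpNorm_le ENNReal.toReal_nonneg hκ hε.le hφ hφε
    (m.eLpNorm_trace_le m.traceConst_ne_top) (m.eLpNorm_trace_le hβ₂) hℓ ?_ ?_
  · have := mul_toReal_le_one_of_ofReal_le_one_div hε.le hε₁
    simp only [ENNReal.toReal_mul, ENNReal.toReal_pow, ENNReal.toReal_ofNat] at this
    rw [ENNReal.coe_toNNReal_eq_toReal]
    linarith
  · have := mul_toReal_le_one_of_ofReal_le_one_div hε.le hε₂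
    simp only [ENNReal.toReal_mul, ENNReal.toReal_pow, ENNReal.toReal_ofNat] at this
    rw [ENNReal.coe_toNNReal_eq_toReal]
    linarith

theorem existsUnique_of_M₀_eq_zero (hM : M₀ Ω ΓD ΓN ΓR Φ g = 0) {ℓ : StrongDual ℝ H}
    (hℓ : ‖ℓ‖ ≤ (M₀ Ω ΓD ΓN ΓR Φ g).toReal / 2) :
    ∃! u : H, ‖u‖ ≤ (M₀ Ω ΓD ΓN ΓR Φ g).toReal ∧ ∀ v, inner ℝ u v +
      ∫ x in ΓR, φ x * (m.trace u x + (2 * α - 1) / 2 * m.trace u x ^ 2) * m.trace v x ∂surf Ω =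
        ℓ v := by
  rw [hM, ENNReal.toReal_zero] at hℓ ⊢
  obtain rfl : ℓ = 0 := by simpa using hℓ
  refine ⟨0, ⟨norm_zero.le, fun v => ?_⟩, fun u hu => norm_le_zero_iff.1 hu.1⟩
  rw [inner_zero_left, zero_add, map_zero, zero_apply]
  refine integral_eq_zero_of_ae (ae_restrict_of_ae ?_)
  filter_upwards [Lp.coeFn_zero ℝ 2 (surf Ω)] with x hx
  rw [hx]
  simp

end HilbertModel

theorem IsBoundaryPartition.measurableSet_robin (hΓ : IsBoundaryPartition Ω ΓD ΓN ΓR) :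
    MeasurableSet ΓR := by
  obtain ⟨U, hU, rfl⟩ := hΓ.openR
  exact hU.measurableSet.inter isClosed_frontier.measurableSet

end WeakSolution

end RobinProblem

end

theorem theorem3p1_general {Ω ΓD ΓN ΓR : Set Plane} (hΩ : IsLipschitzDomain Ω)
    (hD : 0 < surf Ω ΓD) {α : ℝ} (hα : α ∈ Set.Icc (0 : ℝ) 1) {Φ g : Plane → ℝ}
    (hΦ : MemLp Φ 2 ((surf Ω).restrict ΓN)) (hg : MemLp g 2 ((surf Ω).restrict ΓR))
    {ε : ℝ} (hε : 0 < ε)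
    (hε' : ENNReal.ofReal ε ≤ min (1 / (4 * traceConst Ω ΓD ΓR 2 ^ 2))
      (1 / (2 * traceConst Ω ΓD ΓR 3 ^ 3 * M₀ Ω ΓD ΓN ΓR Φ g)))
    {φ : Plane → ℝ} (hφ : AEStronglyMeasurable φ ((surf Ω).restrict ΓR))
    (hφε : eLpNorm φ ∞ ((surf Ω).restrict ΓR) ≤ ENNReal.ofReal ε) :
    ∃ u : V Ω ΓD, IsWeakSolution ΓN ΓR α φ Φ g u ∧ normV u ≤ M₀ Ω ΓD ΓN ΓR Φ g ∧
      ∀ w : V Ω ΓD, IsWeakSolution ΓN ΓR α φ Φ g w → normV w ≤ M₀ Ω ΓD ΓN ΓR Φ g → w = u := by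
  obtain ⟨H, _, _, _, ⟨m⟩⟩ := hΩ.exists_hilbertModel hD
  have hM : M₀ Ω ΓD ΓN ΓR Φ g ≠ ⊤ := M₀_ne_top m.traceConst_ne_top m.traceConst_ne_top hΦ hg
  obtain ⟨ℓ, hℓ, hℓ_apply⟩ := m.exists_load hΦ hg
  have hexists := (eq_or_ne (M₀ Ω ΓD ΓN ΓR Φ g) 0).elim
    (fun h0 => m.existsUnique_of_M₀_eq_zero (α := α) (φ := φ) h0 hℓ)
    (fun h0 => m.existsUnique_of_M₀_ne_zero hα hε hε' hφ hφε h0 hℓ)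
  simp only [hℓ_apply] at hexists
  obtain ⟨h, ⟨hle, hsol⟩, huniq⟩ := hexists
  obtain ⟨u, rfl⟩ := m.equiv.surjective h
  exact ⟨u, m.isWeakSolution_iff.2 hsol, (m.normV_le_iff hM).2 hle, fun w hw hwM =>
    m.equiv.injective (huniq _ ⟨(m.normV_le_iff hM).1 hwM, m.isWeakSolution_iff.1 hw⟩)⟩

theorem theorem3p1 (Ω ΓD ΓN ΓR : Set Plane) (hΩ : IsLipschitzDomain Ω)
    (hΓ : IsBoundaryPartition Ω ΓD ΓN ΓR)
    (α : ℝ) (hα : α ∈ Set.Ioo (0 : ℝ) 1)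
    (Φ g : Plane → ℝ) (hΦ : MemLp Φ 2 ((surf Ω).restrict ΓN))
    (hg : MemLp g 2 ((surf Ω).restrict ΓR))
    (ε : ℝ) (hε : 0 < ε)
    (hε' : ENNReal.ofReal ε < min (1 / (4 * traceConst Ω ΓD ΓR 2 ^ 2))
      (1 / (2 * traceConst Ω ΓD ΓR 3 ^ 3 * M₀ Ω ΓD ΓN ΓR Φ g)))
    (φ : Plane → ℝ) (hφ : ContinuousOn φ (closure ΓR))
    (hφε : eLpNorm φ ∞ ((surf Ω).restrict ΓR) < ENNReal.ofReal ε) :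
    ∃ u : V Ω ΓD, IsWeakSolution ΓN ΓR α φ Φ g u ∧ normV u ≤ M₀ Ω ΓD ΓN ΓR Φ g ∧
      ∀ w : V Ω ΓD, IsWeakSolution ΓN ΓR α φ Φ g w → normV w ≤ M₀ Ω ΓD ΓN ΓR Φ g → w = u := by
  exact theorem3p1_general hΩ hΓ.posD (Set.Ioo_subset_Icc_self hα) hΦ hg hε hε'.le
    ((hφ.mono subset_closure).aestronglyMeasurable hΓ.measurableSet_robin) hφε.le
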